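/- Let $\mathbb F$ be a field of characteristic zero and let $q\in\mathbb F$ be nonzero and not a root of unity. Let $U_q(\widehat{\mathfrak{sl}}_2)$ be the $\mathbb F$-algebra with generators $K_i^{\pm1},D^{\pm1},E_i,F_i$ ($i\in\{0,1\}$) and relations, for $i,j\in\{0,1\}$ and with $\mathbf A=\begin{pmatrix}2&-2\\-2&2\end{pmatrix}$: $K_iK_i^{-1}=K_i^{-1}K_i=1$, $DD^{-1}=D^{-1}D=1$, $[K_i,K_j]=0$, $[D,K_i]=0$, $K_iE_jK_i^{-1}=q^{\mathbf A_{ij}}E_j$, $K_iF_jK_i^{-1}=q^{-\mathbf A_{ij}}F_j$, $DE_0D^{-1}=qE_0$, $DF_0D^{-1}=q^{-1}F_0$, $[D,E_1]=[D,F_1]=0$, $[E_i,F_j]=\delta_{ij}\frac{K_i-K_i^{-1}}{q-q^{-1}}$, and, for $i\ne j$, $[E_i,[E_i,[E_i,E_j]_q]_{q^{-1}}]=0=[F_i,[F_i,[F_i,F_j]_q]_{q^{-1}}]$, where $[a,b]=ab-ba$ and $[a,b]_p=p\,ab-p^{-1}ba$. Let $V(\Lambda_0)$ be the basic module, that is,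 the irreducible highest weight $U_q(\widehat{\mathfrak{sl}}_2)$-module of highest weight $\Lambda_0$: the quotient of the Verma module $U_q(\widehat{\mathfrak{sl}}_2)/J$, where $J$ is the left ideal generated by $E_0,E_1,K_0-q,K_1-1,D-1$, by the sum of all its proper submodules. Let $v_{\Lambda_0}$ be the image of $1$ in it. Let $\mathbb V$ be the free $\mathbb F$-algebra on $x,y$, with basis the words and trivial word $\mathbf 1$. Let $\star$ be the $q$-shuffle product on $\mathbb V$: it is bilinear, has unit $\mathbf 1$, and for nontrivial words $u=u_1\cdots u_r$, $v=v_1\cdots v_s$ one has $u\star v=u_1\bigl((u_2\cdots u_r)\star v\bigr)+q^{(u_1,v_1)+\cdots+(u_r,v_1)}\,v_1\bigl(u\star(v_2\cdots v_s)\bigr)$, where for letters $(a,b)=2$ if $a=b$ and $(a,b)=-2$ if $a\neq b$. Let $\mathbb U$ be the subalgebra of $(\mathbb V,\star)$ generated by $x,y$. Let $X$ (resp. $K$) be the automorphism of the free algebra $\mathbb V$ with $x\mapsto qx,\ y\mapsto y$ (resp. $x\mapsto q^2x,\ y\mapsto q^{-2}y$). Let $A^*_R$ (resp. $B^*_R$)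 be the linear map that deletes the last letter of each word ending in $x$ (resp. $y$) and sends every other word to $0$. Put $A_\ell v=x\star v$, $B_\ell v=y\star v$, $A_rv=v\star x$, $B_rv=v\star y$. Then $\mathbb U$ is, in exactly one way, a $U_q(\widehat{\mathfrak{sl}}_2)$-module on which $$E_0=A^*_R,\quad F_0=\frac{qA_rK^{-1}-q^{-1}A_\ell}{q-q^{-1}},\quad K_0^{\pm1}=q^{\pm1}K^{\mp1},\quad E_1=B^*_R,\quad F_1=\frac{B_rK-B_\ell}{q-q^{-1}},\quad K_1^{\pm1}=K^{\pm1},\quad D^{\pm1}=X^{\mp1}.$$ In this module $K_0\mathbf 1=q\mathbf 1$, $K_1\mathbf 1=\mathbf 1$, $D\mathbf 1=\mathbf 1$, $E_0\mathbf 1=0$, $F_0^2\mathbf 1=0$, $E_1\mathbf 1=0$, $F_1\mathbf 1=0$. Let $\mathbf U$ be the submodule generated by $\mathbf 1$. Then $\mathbf U$ is contained in every nonzero submodule of $\mathbb U$, $\mathbf U$ is irreducible, and the $U_q(\widehat{\mathfrak{sl}}_2)$-modules $\mathbf U$ and $V(\Lambda_0)$ are isomorphic, by an isomorphism that sends $\mathbf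 1$ to $v_{\Lambda_0}$. -/

import Mathlib

noncomputable section

namespace QShuffle

universe u

/-! ### The quantized enveloping algebra of affine `sl₂` -/

/-- The generators `K_i`, `K_i⁻¹`, `D`, `D⁻¹`, `E_i`, `F_i` with `i ∈ {0, 1}`. -/
inductive Gen : Type
  | K (i : Fin 2)
  | Kinv (i : Fin 2)
  | D
  | Dinv
  | E (i : Fin 2)
  | F (i : Fin 2)

/-- The Cartan matrix of affine `sl₂`. -/
def cartan : Matrix (Fin 2) (Fin 2) ℤ := !![2, -2; -2, 2]

section Commutators

variable {𝔽 : Type u} [Field 𝔽] {A : Type u} [Ring A] [Algebra 𝔽 A]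

/-- The commutator `[a, b] = ab - ba`. -/
def comm (a b : A) : A := a * b - b * a

/-- The `p`-commutator `[a, b]_p = p ab - p⁻¹ ba`. -/
def qcomm (p : 𝔽) (a b : A) : A := p • (a * b) - p⁻¹ • (b * a)

end Commutators

section Uq

variable {𝔽 : Type u} [Field 𝔽]

/-- A generator, as an element of the free algebra on all generators. -/
abbrev gen (𝔽 : Type u) [Field 𝔽] (g : Gen) : FreeAlgebra 𝔽 Gen := FreeAlgebra.ι 𝔽 g

/-- The defining relations of `U_q(ŝl₂)`. -/
inductive Rel (q : 𝔽) : FreeAlgebra 𝔽 Gen → FreeAlgebra 𝔽 Gen → Prop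
  | K_Kinv (i : Fin 2) : Rel q (gen 𝔽 (.K i) * gen 𝔽 (.Kinv i)) 1
  | Kinv_K (i : Fin 2) : Rel q (gen 𝔽 (.Kinv i) * gen 𝔽 (.K i)) 1
  | D_Dinv : Rel q (gen 𝔽 .D * gen 𝔽 .Dinv) 1
  | Dinv_D : Rel q (gen 𝔽 .Dinv * gen 𝔽 .D) 1
  | K_K (i j : Fin 2) : Rel q (comm (gen 𝔽 (.K i)) (gen 𝔽 (.K j))) 0
  | D_K (i : Fin 2) : Rel q (comm (gen 𝔽 .D) (gen 𝔽 (.K i))) 0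
  | K_E (i j : Fin 2) :
      Rel q (gen 𝔽 (.K i) * gen 𝔽 (.E j) * gen 𝔽 (.Kinv i))
        (q ^ (cartan i j) • gen 𝔽 (.E j))
  | K_F (i j : Fin 2) :
      Rel q (gen 𝔽 (.K i) * gen 𝔽 (.F j) * gen 𝔽 (.Kinv i))
        (q ^ (-cartan i j) • gen 𝔽 (.F j))
  | D_E_zero :
      Rel q (gen 𝔽 .D * gen 𝔽 (.E 0) * gen 𝔽 .Dinv) (q • gen 𝔽 (.E 0))
  | D_F_zero :
      Rel q (gen 𝔽 .D * gen 𝔽 (.F 0) * gen 𝔽 .Dinv) (q⁻¹ • gen 𝔽 (.F 0))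
  | D_E_one : Rel q (comm (gen 𝔽 .D) (gen 𝔽 (.E 1))) 0
  | D_F_one : Rel q (comm (gen 𝔽 .D) (gen 𝔽 (.F 1))) 0
  | E_F (i j : Fin 2) :
      Rel q (comm (gen 𝔽 (.E i)) (gen 𝔽 (.F j)))
        (if i = j then (q - q⁻¹)⁻¹ • (gen 𝔽 (.K i) - gen 𝔽 (.Kinv i)) else 0)
  | serre_E (i j : Fin 2) (hij : i ≠ j) :
      Rel q (comm (gen 𝔽 (.E i)) (qcomm q⁻¹ (gen 𝔽 (.E i))
        (qcomm q (gen 𝔽 (.E i)) (gen 𝔽 (.E j))))) 0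
  | serre_F (i j : Fin 2) (hij : i ≠ j) :
      Rel q (comm (gen 𝔽 (.F i)) (qcomm q⁻¹ (gen 𝔽 (.F i))
        (qcomm q (gen 𝔽 (.F i)) (gen 𝔽 (.F j))))) 0

/-- The quantized enveloping algebra `U_q(ŝl₂)`. -/
abbrev Uq (q : 𝔽) : Type u := RingQuot (Rel q)

/-- The image of a generator in `U_q(ŝl₂)`. -/
def Uq.of (q : 𝔽) (g : Gen) : Uq q := RingQuot.mkAlgHom 𝔽 (Rel q) (FreeAlgebra.ι 𝔽 g)

end Uq

/-! ### The basic module `V(Λ₀)`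

`V(Λ₀)` is the irreducible highest weight module of highest weight `Λ₀`: the quotient of the
Verma module of highest weight `Λ₀` by the sum of all its proper submodules. -/

section Basic

variable {𝔽 : Type u} [Field 𝔽]

/-- The left ideal of `U_q(ŝl₂)` generated by `E_0`, `E_1`, `K_0 - q`, `K_1 - 1`, `D - 1`. -/
def vermaIdeal (q : 𝔽) : Submodule (Uq q) (Uq q) :=
  Submodule.span (Uq q)
    {Uq.of q (.E 0), Uq.of q (.E 1), Uq.of q (.K 0) - algebraMap 𝔽 (Uq q) q,
      Uq.of q (.K 1) - 1, Uq.of q .D - 1}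

/-- The Verma module `M(Λ₀)`. -/
abbrev Verma (q : 𝔽) : Type u := Uq q ⧸ vermaIdeal q

/-- The sum of all proper submodules of `M(Λ₀)`. -/
def vermaRadical (q : 𝔽) : Submodule (Uq q) (Verma q) :=
  sSup {P : Submodule (Uq q) (Verma q) | P ≠ ⊤}

/-- The basic module `V(Λ₀)`. -/
abbrev VLambda0 (q : 𝔽) : Type u := Verma q ⧸ vermaRadical q

/-- The canonical highest weight vector of `V(Λ₀)`, the image of `1 ∈ U_q(ŝl₂)`. -/
def VLambda0.hwVec (q : 𝔽) : VLambda0 q :=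
  (vermaRadical q).mkQ ((vermaIdeal q).mkQ 1)

end Basic

/-! ### The free algebra `𝕍` and its `q`-shuffle product -/

/-- The two letters `x` and `y`. -/
inductive Letter : Type
  | x
  | y
  deriving DecidableEq

section Shuffle

variable {𝔽 : Type u} [Field 𝔽]

/-- The free algebra `𝕍` on the letters `x`, `y`. -/
abbrev VV (𝔽 : Type u) [Field 𝔽] : Type u := FreeAlgebra 𝔽 Letter

/-- A letter as an element of `𝕍`. -/
abbrev letter (𝔽 : Type u) [Field 𝔽] (a : Letter) : VV 𝔽 := FreeAlgebra.ι 𝔽 a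

/-- A word `ℓ₁ℓ₂⋯ℓₙ` as an element of `𝕍`. -/
def word (𝔽 : Type u) [Field 𝔽] (w : List Letter) : VV 𝔽 := (w.map (letter 𝔽)).prod

/-- The standard basis of `𝕍`, which consists of the words. -/
def wordBasis (𝔽 : Type u) [Field 𝔽] : Module.Basis (List Letter) 𝔽 (VV 𝔽) :=
  (FreeAlgebra.basisFreeMonoid 𝔽 Letter).reindex FreeMonoid.toList

theorem wordBasis_apply (w : List Letter) : wordBasis 𝔽 w = word 𝔽 w := by
  have h : wordBasis 𝔽 w = FreeAlgebra.equivMonoidAlgebraFreeMonoid.symm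
      (MonoidAlgebra.of 𝔽 (FreeMonoid Letter) (FreeMonoid.ofList w)) := by
    simp only [wordBasis, FreeAlgebra.basisFreeMonoid, Module.Basis.reindex_apply,
      Module.Basis.map_apply, Finsupp.coe_basisSingleOne]
    rfl
  rw [h, AlgEquiv.symm_apply_eq]
  clear h
  induction w with
  | nil =>
    simp only [word, FreeMonoid.ofList_nil, map_one, List.map_nil, List.prod_nil]
  | cons a w ih =>
    rw [FreeMonoid.ofList_cons, map_mul, ih]
    simp [word, FreeAlgebra.equivMonoidAlgebraFreeMonoid]

/-- The algebra endomorphism of the free algebra `𝕍` that sends `x ↦ a x` and `y ↦ b y`. -/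
def scale (a b : 𝔽) : VV 𝔽 →ₐ[𝔽] VV 𝔽 :=
  FreeAlgebra.lift 𝔽 fun
    | .x => a • letter 𝔽 .x
    | .y => b • letter 𝔽 .y

/-- The automorphism `X`: `x ↦ q x`, `y ↦ y`. -/
def mapX (q : 𝔽) : VV 𝔽 →ₐ[𝔽] VV 𝔽 := scale q 1

/-- The inverse of `X`. -/
def mapXinv (q : 𝔽) : VV 𝔽 →ₐ[𝔽] VV 𝔽 := scale q⁻¹ 1

/-- The automorphism `K = X²Y⁻²`: `x ↦ q² x`, `y ↦ q⁻² y`. -/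
def mapK (q : 𝔽) : VV 𝔽 →ₐ[𝔽] VV 𝔽 := scale (q ^ (2 : ℤ)) (q ^ (-2 : ℤ))

/-- The inverse of `K`. -/
def mapKinv (q : 𝔽) : VV 𝔽 →ₐ[𝔽] VV 𝔽 := scale (q ^ (-2 : ℤ)) (q ^ (2 : ℤ))

/-- The linear map that removes a final letter `a` from a word, and sends the words that do not
end in `a` (in particular the trivial word) to zero. Thus `A*_R` is `stripR 𝔽 .x` and `B*_R` is
`stripR 𝔽 .y`. -/
def stripR (𝔽 : Type u) [Field 𝔽] (a : Letter) : VV 𝔽 →ₗ[𝔽] VV 𝔽 :=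
  (wordBasis 𝔽).constr 𝔽 fun w => if w.getLast? = some a then word 𝔽 w.dropLast else 0

/-- The form on letters: `(u, v) = 2` if `u = v` and `(u, v) = -2` otherwise. -/
def form (a b : Letter) : ℤ := if a = b then 2 else -2

/-- The `q`-shuffle product of two words, by the recursion
`u ⋆ v = u₁((u₂⋯u_r) ⋆ v) + q^((u₁,v₁)+⋯+(u_r,v₁)) v₁(u ⋆ (v₂⋯v_s))`. -/
def shuffleWord (q : 𝔽) : List Letter → List Letter → VV 𝔽
  | [], v => word 𝔽 v
  | a :: u, [] => word 𝔽 (a :: u)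
  | a :: u, b :: v =>
      letter 𝔽 a * shuffleWord q u (b :: v)
        + q ^ (((a :: u).map fun c => form c b).sum) •
            (letter 𝔽 b * shuffleWord q (a :: u) v)
  termination_by u v => u.length + v.length

/-- The `q`-shuffle product on `𝕍`, the bilinear extension of `shuffleWord`. -/
def star (q : 𝔽) : VV 𝔽 →ₗ[𝔽] VV 𝔽 →ₗ[𝔽] VV 𝔽 :=
  (wordBasis 𝔽).constr 𝔽 fun u => (wordBasis 𝔽).constr 𝔽 fun v => shuffleWord q u v

/-- The subalgebra `𝕌` of the `q`-shuffle algebra generated by `x`, `y`: the smallest subspace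
of `𝕍` that contains `1`, `x`, `y` and is closed under the `q`-shuffle product. -/
def UU (q : 𝔽) : Submodule 𝔽 (VV 𝔽) :=
  sInf {W | (1 : VV 𝔽) ∈ W ∧ letter 𝔽 .x ∈ W ∧ letter 𝔽 .y ∈ W ∧
    ∀ u ∈ W, ∀ v ∈ W, star q u v ∈ W}

theorem one_mem_UU (q : 𝔽) : (1 : VV 𝔽) ∈ UU q :=
  (Submodule.mem_sInf).2 fun _ hW => hW.1

end Shuffle

/-! ### The action of `U_q(ŝl₂)` on `𝕌` -/

section Action

variable {𝔽 : Type u} [Field 𝔽]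

/-- The algebra homomorphism `ρ` makes `𝕌` a `U_q(ŝl₂)`-module on which the generators act by
`E_0 = A*_R`, `F_0 = (q A_r K⁻¹ - q⁻¹ A_ℓ)/(q - q⁻¹)`, `K_0^{±1} = q^{±1} K^{∓1}`,
`E_1 = B*_R`, `F_1 = (B_r K - B_ℓ)/(q - q⁻¹)`, `K_1^{±1} = K^{±1}`, `D^{±1} = X^{∓1}`. -/
structure IsShuffleAction (q : 𝔽) (ρ : Uq q →ₐ[𝔽] Module.End 𝔽 (UU q)) : Prop where
  E_zero (v : UU q) : (ρ (Uq.of q (.E 0)) v : VV 𝔽) = stripR 𝔽 .x v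
  F_zero (v : UU q) : (ρ (Uq.of q (.F 0)) v : VV 𝔽) =
    (q - q⁻¹)⁻¹ • (q • star q (mapKinv q v) (letter 𝔽 .x) - q⁻¹ • star q (letter 𝔽 .x) v)
  K_zero (v : UU q) : (ρ (Uq.of q (.K 0)) v : VV 𝔽) = q • mapKinv q v
  Kinv_zero (v : UU q) : (ρ (Uq.of q (.Kinv 0)) v : VV 𝔽) = q⁻¹ • mapK q v
  E_one (v : UU q) : (ρ (Uq.of q (.E 1)) v : VV 𝔽) = stripR 𝔽 .y v
  F_one (v : UU q) : (ρ (Uq.of q (.F 1)) v : VV 𝔽) =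
    (q - q⁻¹)⁻¹ • (star q (mapK q v) (letter 𝔽 .y) - star q (letter 𝔽 .y) v)
  K_one (v : UU q) : (ρ (Uq.of q (.K 1)) v : VV 𝔽) = mapK q v
  Kinv_one (v : UU q) : (ρ (Uq.of q (.Kinv 1)) v : VV 𝔽) = mapKinv q v
  D (v : UU q) : (ρ (Uq.of q .D) v : VV 𝔽) = mapXinv q v
  Dinv (v : UU q) : (ρ (Uq.of q .Dinv) v : VV 𝔽) = mapX q v

/-- The vector space `𝕌`, regarded as a `U_q(ŝl₂)`-module through `ρ`. -/
def UModule {q : 𝔽} (_ρ : Uq q →ₐ[𝔽] Module.End 𝔽 (UU q)) : Type u := UU q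

instance {q : 𝔽} (ρ : Uq q →ₐ[𝔽] Module.End 𝔽 (UU q)) : AddCommGroup (UModule ρ) :=
  inferInstanceAs (AddCommGroup (UU q))

instance {q : 𝔽} (ρ : Uq q →ₐ[𝔽] Module.End 𝔽 (UU q)) : Module (Uq q) (UModule ρ) :=
  Module.compHom (UU q) (ρ : Uq q →+* Module.End 𝔽 (UU q))

/-- The trivial word `1`, as a vector of the module `𝕌`. -/
def vac {q : 𝔽} (ρ : Uq q →ₐ[𝔽] Module.End 𝔽 (UU q)) : UModule ρ :=
  (⟨1, one_mem_UU q⟩ : UU q)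

/-- The submodule `𝐔` of the module `𝕌` generated by the trivial word. -/
def boldU {q : 𝔽} (ρ : Uq q →ₐ[𝔽] Module.End 𝔽 (UU q)) : Submodule (Uq q) (UModule ρ) :=
  Submodule.span (Uq q) {vac ρ}

theorem vac_mem_boldU {q : 𝔽} (ρ : Uq q →ₐ[𝔽] Module.End 𝔽 (UU q)) : vac ρ ∈ boldU ρ :=
  Submodule.mem_span_singleton_self _

/-- `v` satisfies the relations `K_0 v = q v`, `K_1 v = v`, `D v = v`, `E_0 v = 0`, `F_0² v = 0`,
`E_1 v = 0`, `F_1 v = 0`. -/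
structure IsBasicVector (q : 𝔽) {M : Type u} [AddCommGroup M] [Module (Uq q) M] (v : M) :
    Prop where
  K_zero : Uq.of q (.K 0) • v = algebraMap 𝔽 (Uq q) q • v
  K_one : Uq.of q (.K 1) • v = v
  D : Uq.of q .D • v = v
  E_zero : Uq.of q (.E 0) • v = 0
  F_zero : Uq.of q (.F 0) ^ 2 • v = 0
  E_one : Uq.of q (.E 1) • v = 0
  F_one : Uq.of q (.F 1) • v = 0

end Action

end QShuffle

end

/-!
Write `∂_c` for the deletion of a final letter `c` (`stripR 𝔽 c`). Everything rests on two facts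
about deletions. First, they lower the degree, and an element with vanishing deletions is a scalar;
so statements about `𝕍` can be proved by passing to deletions (`strip_induction`,
`eq_of_stripR_eq`). Second, `∂_c` is a `q`-derivation of the `q`-shuffle product:
`∂_c (u ⋆ v) = u ⋆ ∂_c v + ∂_c u ⋆ κ_c v` with `κ_x = K` and `κ_y = K⁻¹` (`stripR_star`). Together
they show that `⋆` is associative and that rescaling the letters is an automorphism of it, so that
`𝕌` is what left multiplications by letters make of `1` (`UU_induction`).

*The action.* All defining relations except the Serre relation for the `E_i` hold on the whole of
`𝕍`. The weight relations and `[E_i, F_j]` are direct computations with the `q`-derivation rule.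
From these, the Serre element of the `F_i` commutes with `E_0 = ∂_x` and `E_1 = ∂_y`, while its
image contains no constants, so it vanishes by induction on degree (`serre_opVV_F`). The Serre
element of the `E_i` does not vanish on `𝕍`, but it commutes with left multiplication by `x` and
`y` and kills `1`, so it vanishes on `𝕌` (`serre_stripR_eq_zero`). Both commutations are
instances of the same computation in an associative algebra (`commute_serre_left`,
`commute_serre_right`).

*The submodule `𝐔`.* Deleting letters from a nonzero vector as long as possible ends in a nonzero
scalar, so every nonzero submodule contains `1` (`IsShuffleAction.boldU_le`). Hence `𝐔` is contained
in each of them, and is simple.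

*The isomorphism.* Since `1` is a vector of highest weight `Λ₀`, the Verma module maps onto `𝐔`, and
it remains to see that the kernel is the sum of all proper submodules (`ker_vermaToUU`). It is
proper, as `1 ≠ 0`. Conversely, suppose that a submodule `N` is not contained in the kernel; then
its image contains `1`. The Verma module is spanned by its generator `v` and by words
of positive length in the `F_i` applied to `v`; the latter have images without constant
coefficient, so some `v + m` with `m` in their span lies in `N`. The element `D³K₁` fixes `v` and
acts on such words by scalars `q ^ (-d)`, `d > 0`, which differ from `1` as `q` is not a root of
unity. A polynomial in it therefore sends `v + m` to a nonzero multiple of `v`, so `N` is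
everything.
-/

namespace QShuffle

universe u

/-! ### Words, deletion of the last letter, and rescaling of the letters -/

section Words

variable {𝔽 : Type u} [Field 𝔽]

theorem word_nil : word 𝔽 [] = 1 := by simp [word]

theorem word_cons (a : Letter) (w : List Letter) : word 𝔽 (a :: w) = letter 𝔽 a * word 𝔽 w := by
  simp [word]

theorem word_concat (w : List Letter) (a : Letter) :
    word 𝔽 (w ++ [a]) = word 𝔽 w * letter 𝔽 a := by
  simp [word]

/-- Two linear maps on `𝕍` that agree on words are equal. -/
theorem ext_word {M : Type*} [AddCommMonoid M] [Module 𝔽 M] {f g : VV 𝔽 →ₗ[𝔽] M}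
    (h : ∀ w, f (word 𝔽 w) = g (word 𝔽 w)) : f = g :=
  (wordBasis 𝔽).ext fun w => by rw [wordBasis_apply, h]

theorem stripR_word (a : Letter) (w : List Letter) :
    stripR 𝔽 a (word 𝔽 w) = if w.getLast? = some a then word 𝔽 w.dropLast else 0 := by
  rw [← wordBasis_apply, stripR, Module.Basis.constr_basis]

theorem stripR_one (a : Letter) : stripR 𝔽 a 1 = 0 := by
  rw [← word_nil, stripR_word]; simp

theorem stripR_mul_letter (c d : Letter) (v : VV 𝔽) :
    stripR 𝔽 c (v * letter 𝔽 d) = if d = c then v else 0 := by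
  have : stripR 𝔽 c ∘ₗ LinearMap.mulRight 𝔽 (letter 𝔽 d) =
      if d = c then LinearMap.id else 0 := by
    refine ext_word fun w => ?_
    simp only [LinearMap.comp_apply, LinearMap.mulRight_apply]
    rw [← word_concat, stripR_word]
    by_cases h : d = c <;> simp [h]
  have h := LinearMap.congr_fun this v
  by_cases hd : d = c <;> simpa [hd] using h

theorem stripR_letter (c d : Letter) :
    stripR 𝔽 c (letter 𝔽 d) = if d = c then 1 else 0 := by
  simpa using stripR_mul_letter c d (1 : VV 𝔽)

/-- The constant coefficient of an element of `𝕍`. -/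
abbrev eps : VV 𝔽 →ₐ[𝔽] 𝔽 := FreeAlgebra.algebraMapInv

theorem eps_letter (a : Letter) : eps (letter 𝔽 a) = 0 := by
  simp [eps, FreeAlgebra.algebraMapInv]

/-- An element of `𝕍` is recovered from its constant coefficient and its two deletions. -/
theorem eq_eps_add_stripR (v : VV 𝔽) :
    v = eps v • 1 + stripR 𝔽 .x v * letter 𝔽 .x + stripR 𝔽 .y v * letter 𝔽 .y := by
  have : LinearMap.id = (eps (𝔽 := 𝔽)).toLinearMap.smulRight (1 : VV 𝔽)
      + LinearMap.mulRight 𝔽 (letter 𝔽 .x) ∘ₗ stripR 𝔽 .x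
      + LinearMap.mulRight 𝔽 (letter 𝔽 .y) ∘ₗ stripR 𝔽 .y := by
    refine ext_word fun w => ?_
    rcases List.eq_nil_or_concat' w with rfl | ⟨w, d, rfl⟩
    · simp [word_nil, stripR_one]
    · rw [word_concat]
      cases d <;> simp [stripR_mul_letter, eps_letter]
  exact LinearMap.congr_fun this v

theorem eq_of_stripR_eq {v w : VV 𝔽} (h0 : eps v = eps w)
    (h : ∀ c, stripR 𝔽 c v = stripR 𝔽 c w) : v = w := by
  rw [eq_eps_add_stripR v, eq_eps_add_stripR w, h0, h, h]

theorem stripR_letter_mul (c a : Letter) (v : VV 𝔽) :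
    stripR 𝔽 c (letter 𝔽 a * v) =
      letter 𝔽 a * stripR 𝔽 c v + if a = c then eps v • 1 else 0 := by
  conv_lhs => rw [eq_eps_add_stripR v]
  simp only [mul_add, ← mul_assoc, map_add, stripR_mul_letter, mul_smul_comm, map_smul, mul_one,
    stripR_letter]
  cases c <;> cases a <;> simp <;> abel

/-- `v` is killed by every composite of `n` deletions. -/
def StripNilpotent : ℕ → VV 𝔽 → Prop
  | 0, v => v = 0
  | n + 1, v => ∀ c, StripNilpotent n (stripR 𝔽 c v)

theorem StripNilpotent.zero (n : ℕ) : StripNilpotent n (0 : VV 𝔽) := by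
  induction n with
  | zero => rfl
  | succ n ih => intro c; simpa using ih

theorem StripNilpotent.mono {n : ℕ} {v : VV 𝔽} (h : StripNilpotent n v) (m : ℕ) :
    StripNilpotent (n + m) v := by
  induction n generalizing v with
  | zero => rw [show v = 0 from h]; exact StripNilpotent.zero _
  | succ n ih => rw [Nat.succ_add]; exact fun c => ih (h c)

theorem StripNilpotent.add {n : ℕ} {v w : VV 𝔽} (hv : StripNilpotent n v)
    (hw : StripNilpotent n w) : StripNilpotent n (v + w) := by
  induction n generalizing v w with
  | zero => rw [show v = 0 from hv, show w = 0 from hw, add_zero]; rfl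
  | succ n ih => intro c; rw [map_add]; exact ih (hv c) (hw c)

theorem StripNilpotent.smul {n : ℕ} {v : VV 𝔽} (a : 𝔽) (hv : StripNilpotent n v) :
    StripNilpotent n (a • v) := by
  induction n generalizing v with
  | zero => rw [show v = 0 from hv, smul_zero]; rfl
  | succ n ih => intro c; rw [map_smul]; exact ih (hv c)

theorem stripNilpotent_word (w : List Letter) : StripNilpotent (w.length + 1) (word 𝔽 w) := by
  induction w using List.reverseRecOn with
  | nil => intro c; rw [word_nil, stripR_one]; rfl
  | append_singleton w d ih =>
    intro c
    rw [word_concat, stripR_mul_letter]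
    split_ifs
    · simpa using ih
    · exact StripNilpotent.zero _

theorem exists_stripNilpotent (v : VV 𝔽) : ∃ n, StripNilpotent n v := by
  have hv : v ∈ Submodule.span 𝔽 (Set.range (wordBasis 𝔽)) := by
    rw [Module.Basis.span_eq]; trivial
  induction hv using Submodule.span_induction with
  | mem v h =>
    obtain ⟨w, rfl⟩ := h
    rw [wordBasis_apply]
    exact ⟨_, stripNilpotent_word w⟩
  | zero => exact ⟨0, rfl⟩
  | add v w _ _ hv hw =>
    obtain ⟨n, hn⟩ := hv
    obtain ⟨m, hm⟩ := hw
    exact ⟨n + m, (hn.mono m).add (by rw [add_comm]; exact hm.mono n)⟩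
  | smul a v _ hv =>
    obtain ⟨n, hn⟩ := hv
    exact ⟨n, hn.smul a⟩

/-- Induction on degree in `𝕍`: deletions lower the degree, so a property passes from the
deletions of `v` to `v`. -/
theorem strip_induction {P : VV 𝔽 → Prop} (zero : P 0)
    (step : ∀ v, (∀ c, P (stripR 𝔽 c v)) → P v) (v : VV 𝔽) : P v := by
  obtain ⟨n, hn⟩ := exists_stripNilpotent v
  induction n generalizing v with
  | zero => rw [show v = 0 from hn]; exact zero
  | succ n ih => exact step v fun c => ih _ (hn c)

/-- The factor by which `scale a b` multiplies a letter. -/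
def wt (a b : 𝔽) : Letter → 𝔽
  | .x => a
  | .y => b

theorem scale_letter (a b : 𝔽) (c : Letter) :
    scale a b (letter 𝔽 c) = wt a b c • letter 𝔽 c := by
  cases c <;> simp [scale, wt]

theorem eps_scale (a b : 𝔽) (v : VV 𝔽) : eps (scale a b v) = eps v := by
  have : eps.comp (scale a b) = eps := by
    ext c
    simp only [Function.comp_apply, AlgHom.comp_apply]
    rw [scale_letter, map_smul, eps_letter, smul_zero]
  exact DFunLike.congr_fun this v

theorem stripR_scale (a b : 𝔽) (c : Letter) (v : VV 𝔽) :
    stripR 𝔽 c (scale a b v) = wt a b c • scale a b (stripR 𝔽 c v) := by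
  conv_lhs => rw [eq_eps_add_stripR v]
  simp only [map_add, map_mul, map_smul, map_one, stripR_one, scale_letter, mul_smul_comm,
    stripR_mul_letter]
  cases c <;> simp [wt]

theorem scale_scale (a b a' b' : 𝔽) (v : VV 𝔽) :
    scale a b (scale a' b' v) = scale (a * a') (b * b') v := by
  have : (scale a b).comp (scale a' b') = scale (a * a') (b * b') := by
    ext c
    cases c <;> simp [scale, smul_smul, mul_comm]
  exact DFunLike.congr_fun this v

theorem scale_one_one (v : VV 𝔽) : scale 1 1 v = v := by
  have : scale (1 : 𝔽) 1 = AlgHom.id 𝔽 (VV 𝔽) := by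
    ext c
    cases c <;> simp [scale]
  exact DFunLike.congr_fun this v

/-- The automorphism of `𝕍` that multiplies each letter `a` by `q ^ (a, c)`; it is `K` for `c = x`
and `K⁻¹` for `c = y`. -/
def kap (q : 𝔽) (c : Letter) : VV 𝔽 →ₐ[𝔽] VV 𝔽 := scale (q ^ form .x c) (q ^ form .y c)

theorem kap_x (q : 𝔽) : kap q .x = mapK q := by simp [kap, mapK, form]

theorem kap_y (q : 𝔽) : kap q .y = mapKinv q := by simp [kap, mapKinv, form]

theorem kap_letter (q : 𝔽) (a c : Letter) :
    kap q c (letter 𝔽 a) = q ^ form a c • letter 𝔽 a := by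
  rw [kap, scale_letter]
  cases a <;> rfl

theorem stripR_kap (q : 𝔽) (a c : Letter) (v : VV 𝔽) :
    stripR 𝔽 a (kap q c v) = q ^ form a c • kap q c (stripR 𝔽 a v) := by
  rw [kap, stripR_scale]
  cases a <;> rfl

theorem form_comm (a b : Letter) : form a b = form b a := by
  cases a <;> cases b <;> rfl

theorem kap_word {q : 𝔽} (hq : q ≠ 0) (c : Letter) (w : List Letter) :
    kap q c (word 𝔽 w) = q ^ (w.map fun a => form a c).sum • word 𝔽 w := by
  induction w with
  | nil => simp [word_nil]
  | cons a w ih =>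
    simp only [word_cons, map_mul, ih, kap_letter, List.map_cons, List.sum_cons, zpow_add₀ hq,
      smul_mul_smul_comm]

end Words

/-! ### The `q`-shuffle product -/

section Star

variable {𝔽 : Type u} [Field 𝔽] {q : 𝔽}

theorem star_word (u v : List Letter) : star q (word 𝔽 u) (word 𝔽 v) = shuffleWord q u v := by
  rw [← wordBasis_apply, ← wordBasis_apply, star, Module.Basis.constr_basis,
    Module.Basis.constr_basis]

theorem star_one_left (v : VV 𝔽) : star q 1 v = v := by
  have : star q 1 = LinearMap.id := by
    refine ext_word fun w => ?_
    rw [← word_nil, star_word, shuffleWord]; rfl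
  exact LinearMap.congr_fun this v

theorem star_one_right (v : VV 𝔽) : star q v 1 = v := by
  have : (star q).flip 1 = LinearMap.id := by
    refine ext_word fun w => ?_
    rw [LinearMap.flip_apply, ← word_nil, star_word]
    cases w <;> rw [shuffleWord] <;> rfl
  exact LinearMap.congr_fun this v

/-- The bilinear form of the recursion that defines the `q`-shuffle product. -/
theorem star_letter_mul_letter_mul (hq : q ≠ 0) (a b : Letter) (u v : VV 𝔽) :
    star q (letter 𝔽 a * u) (letter 𝔽 b * v) =
      letter 𝔽 a * star q u (letter 𝔽 b * v)
        + letter 𝔽 b * star q (kap q b (letter 𝔽 a * u)) v := by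
  let la := LinearMap.mulLeft 𝔽 (letter 𝔽 a)
  let lb := LinearMap.mulLeft 𝔽 (letter 𝔽 b)
  have : (star q).compl₁₂ la lb = ((star q).compl₁₂ LinearMap.id lb).compr₂ la
      + ((star q).compl₁₂ ((kap q b).toLinearMap ∘ₗ la) LinearMap.id).compr₂ lb := by
    refine ext_word fun u => ext_word fun v => ?_
    simp only [LinearMap.compl₁₂_apply, LinearMap.compr₂_apply, LinearMap.add_apply, la, lb,
      LinearMap.mulLeft_apply, LinearMap.comp_apply, LinearMap.id_apply, AlgHom.toLinearMap_apply]
    rw [← word_cons, ← word_cons, kap_word hq, map_smul, LinearMap.smul_apply, star_word,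
      star_word, star_word, shuffleWord, mul_smul_comm]
  exact LinearMap.congr_fun₂ this u v

theorem eps_star (hq : q ≠ 0) (u v : VV 𝔽) : eps (star q u v) = eps u * eps v := by
  have : (star q).compr₂ (eps (𝔽 := 𝔽)).toLinearMap =
      (LinearMap.mul 𝔽 𝔽).compl₁₂ eps.toLinearMap eps.toLinearMap := by
    refine ext_word fun u => ext_word fun v => ?_
    simp only [LinearMap.compl₁₂_apply, LinearMap.compr₂_apply, AlgHom.toLinearMap_apply,
      LinearMap.mul_apply']
    cases u with
    | nil => rw [word_nil, star_one_left, map_one, one_mul]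
    | cons a u =>
      cases v with
      | nil => rw [word_nil, star_one_right, map_one, mul_one]
      | cons b v =>
        rw [word_cons, word_cons, star_letter_mul_letter_mul hq]
        simp only [map_add, map_mul, eps_letter, zero_mul, add_zero]
  exact LinearMap.congr_fun₂ this u v

/-- Deletion of a final letter `c` is a `q`-derivation of the `q`-shuffle product. -/
theorem stripR_star (hq : q ≠ 0) (c : Letter) (u v : VV 𝔽) :
    stripR 𝔽 c (star q u v) =
      star q u (stripR 𝔽 c v) + star q (stripR 𝔽 c u) (kap q c v) := by
  have : (star q).compr₂ (stripR 𝔽 c) = (star q).compl₁₂ LinearMap.id (stripR 𝔽 c)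
      + (star q).compl₁₂ (stripR 𝔽 c) (kap q c).toLinearMap := by
    refine ext_word fun u => ?_
    induction u with
    | nil =>
      refine LinearMap.ext fun v => ?_
      simp [word_nil, star_one_left, stripR_one]
    | cons a u ihu =>
      refine ext_word fun v => ?_
      induction v with
      | nil => simp [word_nil, star_one_right, stripR_one]
      | cons b v ihv =>
        have hu := LinearMap.congr_fun ihu (letter 𝔽 b * word 𝔽 v)
        -- `kap q b` multiplies the word `a :: u` by a scalar, so `ihv` applies to its image too
        have hv : stripR 𝔽 c (star q (kap q b (word 𝔽 (a :: u))) (word 𝔽 v)) =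
            star q (kap q b (word 𝔽 (a :: u))) (stripR 𝔽 c (word 𝔽 v))
            + star q (stripR 𝔽 c (kap q b (word 𝔽 (a :: u)))) (kap q c (word 𝔽 v)) := by
          rw [kap_word hq]
          simp only [map_smul, LinearMap.smul_apply, ← smul_add]
          congr 1
        simp only [LinearMap.compl₁₂_apply, LinearMap.compr₂_apply, LinearMap.add_apply,
          LinearMap.id_apply, AlgHom.toLinearMap_apply] at hu ⊢
        rw [word_cons] at hv
        have e0 : eps (star q (word 𝔽 u) (letter 𝔽 b * word 𝔽 v)) = 0 := by
          rw [eps_star hq, map_mul, eps_letter, zero_mul, mul_zero]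
        have e1 : (eps (star q (kap q b (letter 𝔽 a * word 𝔽 u)) (word 𝔽 v)) : 𝔽) =
            0 := by
          rw [eps_star hq, map_mul, map_mul, kap_letter, map_smul, eps_letter, smul_zero,
            zero_mul, zero_mul]
        rw [word_cons, word_cons, star_letter_mul_letter_mul hq, map_add, stripR_letter_mul c a,
          stripR_letter_mul c b, hu, hv, e0, e1, stripR_kap, stripR_letter_mul c a,
          stripR_letter_mul c b, form_comm c b]
        have k0 : kap q c (letter 𝔽 b * word 𝔽 v) =
            letter 𝔽 b * (q ^ form b c • kap q c (word 𝔽 v)) := by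
          rw [map_mul, kap_letter, smul_mul_assoc, mul_smul_comm]
        simp only [map_add, LinearMap.add_apply, k0, star_letter_mul_letter_mul hq]
        by_cases hac : a = c <;> by_cases hbc : b = c <;>
          simp [hac, hbc, star_one_left, star_one_right, mul_add, kap_letter] <;> abel
  exact LinearMap.congr_fun₂ this u v

theorem scale_star (hq : q ≠ 0) (a b : 𝔽) (u v : VV 𝔽) :
    scale a b (star q u v) = star q (scale a b u) (scale a b v) := by
  induction u using strip_induction generalizing v with
  | zero => simp
  | step u ihu =>
    induction v using strip_induction with
    | zero => simp
    | step v ihv =>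
      refine eq_of_stripR_eq (by simp only [eps_scale, eps_star hq]) fun c => ?_
      have hk : kap q c (scale a b v) = scale a b (kap q c v) := by
        simp only [kap, scale_scale, mul_comm]
      simp only [stripR_scale, stripR_star hq, map_add, ihu, ihv, map_smul, LinearMap.smul_apply,
        smul_add, hk]

theorem star_assoc (hq : q ≠ 0) (u v w : VV 𝔽) :
    star q (star q u v) w = star q u (star q v w) := by
  induction u using strip_induction generalizing v w with
  | zero => simp
  | step u ihu =>
    induction v using strip_induction generalizing w with
    | zero => simp
    | step v ihv =>
      induction w using strip_induction with
      | zero => simp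
      | step w ihw =>
        refine eq_of_stripR_eq (by simp only [eps_star hq, mul_assoc]) fun c => ?_
        have hk : kap q c (star q v w) = star q (kap q c v) (kap q c w) := scale_star hq _ _ _ _
        simp only [stripR_star hq, map_add, LinearMap.add_apply, ihu, ihv, ihw, hk, add_assoc]

theorem letter_mem_UU (c : Letter) : letter 𝔽 c ∈ UU q :=
  Submodule.mem_sInf.2 fun _ hW => by
    cases c
    · exact hW.2.1
    · exact hW.2.2.1

theorem star_mem_UU {u v : VV 𝔽} (hu : u ∈ UU q) (hv : v ∈ UU q) : star q u v ∈ UU q :=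
  Submodule.mem_sInf.2 fun W hW =>
    hW.2.2.2 u (Submodule.mem_sInf.1 hu W hW) v (Submodule.mem_sInf.1 hv W hW)

/-- The algebra `𝕌` is the smallest subspace that contains `1` and is stable under left
multiplication by the letters. -/
theorem UU_induction (hq : q ≠ 0) {P : VV 𝔽 → Prop} (one : P 1)
    (add : ∀ u v, P u → P v → P (u + v)) (smul : ∀ (a : 𝔽) u, P u → P (a • u))
    (mul : ∀ c, ∀ u ∈ UU q, P u → P (star q (letter 𝔽 c) u)) {v : VV 𝔽} (hv : v ∈ UU q) :
    P v := by
  -- the elements of `𝕌` such that left multiplication by them preserves `P` on `𝕌`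
  let W : Submodule 𝔽 (VV 𝔽) :=
    { carrier := {u | u ∈ UU q ∧ ∀ v ∈ UU q, P v → P (star q u v)}
      zero_mem' := ⟨zero_mem _, fun v _ hv => by simpa using smul 0 v hv⟩
      add_mem' := fun {u u'} hu hu' => ⟨add_mem hu.1 hu'.1, fun v hv h => by
        rw [map_add]; exact add _ _ (hu.2 v hv h) (hu'.2 v hv h)⟩
      smul_mem' := fun a u hu => ⟨Submodule.smul_mem _ a hu.1, fun v hv h => by
        rw [map_smul]; exact smul _ _ (hu.2 v hv h)⟩ }
  have hW : v ∈ W := Submodule.mem_sInf.1 hv W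
    ⟨⟨one_mem_UU q, fun v _ h => by rwa [star_one_left]⟩,
      ⟨letter_mem_UU _, fun v hv h => mul _ v hv h⟩,
      ⟨letter_mem_UU _, fun v hv h => mul _ v hv h⟩,
      fun u hu u' hu' => ⟨star_mem_UU hu.1 hu'.1, fun v hv h => by
        rw [star_assoc hq]
        exact hu.2 _ (star_mem_UU hu'.1 hv) (hu'.2 v hv h)⟩⟩
  simpa [star_one_right] using hW.2 1 (one_mem_UU q) one

theorem scale_mem_UU (hq : q ≠ 0) (a b : 𝔽) {v : VV 𝔽} (hv : v ∈ UU q) :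
    scale a b v ∈ UU q := by
  refine UU_induction (P := fun v => scale a b v ∈ UU q) hq ?_ ?_ ?_ ?_ hv
  · rw [map_one]; exact one_mem_UU q
  · intro u v hu hv; rw [map_add]; exact add_mem hu hv
  · intro c u hu; rw [map_smul]; exact Submodule.smul_mem _ c hu
  · intro c u _ hu
    rw [scale_star hq, scale_letter]
    exact star_mem_UU (Submodule.smul_mem _ _ (letter_mem_UU c)) hu

theorem stripR_letter_star (hq : q ≠ 0) (c a : Letter) (v : VV 𝔽) :
    stripR 𝔽 c (star q (letter 𝔽 a) v) =
      star q (letter 𝔽 a) (stripR 𝔽 c v) + if a = c then kap q c v else 0 := by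
  rw [stripR_star hq, stripR_letter]
  split_ifs <;> simp [star_one_left]

theorem stripR_mem_UU (hq : q ≠ 0) (c : Letter) {v : VV 𝔽} (hv : v ∈ UU q) :
    stripR 𝔽 c v ∈ UU q := by
  refine UU_induction (P := fun v => stripR 𝔽 c v ∈ UU q) hq ?_ ?_ ?_ ?_ hv
  · rw [stripR_one]; exact zero_mem _
  · intro u v hu hv; rw [map_add]; exact add_mem hu hv
  · intro c u hu; rw [map_smul]; exact Submodule.smul_mem _ c hu
  · intro a u hu' hu
    rw [stripR_letter_star hq]
    refine add_mem (star_mem_UU (letter_mem_UU a) hu) ?_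
    split_ifs
    · exact scale_mem_UU hq _ _ hu'
    · exact zero_mem _

end Star

/-! ### The `q`-Serre element -/

section Serre

variable {𝔽 : Type u} [Field 𝔽] {A : Type u} [Ring A] [Algebra 𝔽 A]

/-- The left-hand side of the `q`-Serre relation. -/
abbrev serre (q : 𝔽) (a b : A) : A := comm a (qcomm q⁻¹ a (qcomm q a b))

/-- If `[e, f] = k - k'` and `[e, g] = 0`, where `k` and `k'` `q`-commute with `f` and `g` as the
Cartan elements do, then `e` commutes with the `q`-Serre element of `f` and `g`. -/
theorem commute_serre_left {q : 𝔽} (hq : q ≠ 0) {e f g k k' : A} (hf : e * f = f * e + (k - k'))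
    (hg : e * g = g * e) (hkf : k * f = (q ^ 2)⁻¹ • (f * k)) (hkg : k * g = q ^ 2 • (g * k))
    (hkf' : k' * f = q ^ 2 • (f * k')) (hkg' : k' * g = (q ^ 2)⁻¹ • (g * k')) :
    e * serre q f g = serre q f g * e := by
  have hf2 (z : A) : e * (f * z) = f * (e * z) + (k * z - k' * z) := by
    rw [← mul_assoc, hf]; noncomm_ring
  have hg2 (z : A) : e * (g * z) = g * (e * z) := by rw [← mul_assoc, hg, mul_assoc]
  have hkf2 (z : A) : k * (f * z) = (q ^ 2)⁻¹ • (f * (k * z)) := by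
    rw [← mul_assoc, hkf, smul_mul_assoc, mul_assoc]
  have hkg2 (z : A) : k * (g * z) = q ^ 2 • (g * (k * z)) := by
    rw [← mul_assoc, hkg, smul_mul_assoc, mul_assoc]
  have hkf2' (z : A) : k' * (f * z) = q ^ 2 • (f * (k' * z)) := by
    rw [← mul_assoc, hkf', smul_mul_assoc, mul_assoc]
  have hkg2' (z : A) : k' * (g * z) = (q ^ 2)⁻¹ • (g * (k' * z)) := by
    rw [← mul_assoc, hkg', smul_mul_assoc, mul_assoc]
  simp only [serre, comm, qcomm, mul_sub, sub_mul, mul_add, mul_smul_comm, smul_mul_assoc,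
    mul_assoc, hf, hg, hkf, hkg, hkf', hkg', hf2, hg2, hkf2, hkg2, hkf2', hkg2', smul_sub,
    smul_add, smul_smul]
  match_scalars <;> field_simp <;> ring

/-- If `[e, g] = k - k'` and `[e, f] = 0`, where `k` and `k'` `q`-commute with `f` as the Cartan
elements do, then `e` commutes with the `q`-Serre element of `f` and `g`. -/
theorem commute_serre_right {q : 𝔽} (hq : q ≠ 0) {e f g k k' : A} (hf : e * f = f * e)
    (hg : e * g = g * e + (k - k')) (hkf : k * f = q ^ 2 • (f * k))
    (hkf' : k' * f = (q ^ 2)⁻¹ • (f * k')) :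
    e * serre q f g = serre q f g * e := by
  have hg2 (z : A) : e * (g * z) = g * (e * z) + (k * z - k' * z) := by
    rw [← mul_assoc, hg]; noncomm_ring
  have hf2 (z : A) : e * (f * z) = f * (e * z) := by rw [← mul_assoc, hf, mul_assoc]
  have hkf2 (z : A) : k * (f * z) = q ^ 2 • (f * (k * z)) := by
    rw [← mul_assoc, hkf, smul_mul_assoc, mul_assoc]
  have hkf2' (z : A) : k' * (f * z) = (q ^ 2)⁻¹ • (f * (k' * z)) := by
    rw [← mul_assoc, hkf', smul_mul_assoc, mul_assoc]
  simp only [serre, comm, qcomm, mul_sub, sub_mul, mul_add, mul_smul_comm, smul_mul_assoc,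
    mul_assoc, hf, hg, hkf, hkf', hf2, hg2, hkf2, hkf2', smul_sub,
    smul_add, smul_smul]
  match_scalars <;> field_simp <;> ring

end Serre

/-! ### The operators on `𝕍` and their relations -/

section Operators

variable {𝔽 : Type u} [Field 𝔽]

/-- The operators on `𝕍` by which the generators of `U_q(ŝl₂)` act. -/
noncomputable def opVV (q : 𝔽) : Gen → Module.End 𝔽 (VV 𝔽)
  | .K i => ![q • (mapKinv q).toLinearMap, (mapK q).toLinearMap] i
  | .Kinv i => ![q⁻¹ • (mapK q).toLinearMap, (mapKinv q).toLinearMap] i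
  | .D => (mapXinv q).toLinearMap
  | .Dinv => (mapX q).toLinearMap
  | .E i => ![stripR 𝔽 .x, stripR 𝔽 .y] i
  | .F i => (q - q⁻¹)⁻¹ •
      ![q • (star q).flip (letter 𝔽 .x) ∘ₗ (mapKinv q).toLinearMap - q⁻¹ • star q (letter 𝔽 .x),
        (star q).flip (letter 𝔽 .y) ∘ₗ (mapK q).toLinearMap - star q (letter 𝔽 .y)] i

/-- A linear endomorphism of `𝕍` that commutes with both deletions and has no constant
coefficients in its image vanishes, by induction on degree. -/
theorem eq_zero_of_commute_stripR {T : Module.End 𝔽 (VV 𝔽)}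
    (hT : ∀ c, stripR 𝔽 c * T = T * stripR 𝔽 c) (h0 : ∀ v, eps (T v) = 0) : T = 0 := by
  refine LinearMap.ext fun v => ?_
  induction v using strip_induction with
  | zero => simp
  | step v ih =>
    refine eq_of_stripR_eq (by simp [h0]) fun c => ?_
    have := LinearMap.congr_fun (hT c) v
    simp only [Module.End.mul_apply] at this
    simp [this, ih]

variable {q : 𝔽}

theorem eps_opVV_F (hq : q ≠ 0) (i : Fin 2) (v : VV 𝔽) : eps (opVV q (.F i) v) = 0 := by
  fin_cases i <;> simp [opVV, eps_star hq, eps_letter]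

theorem opVV_K_mul_Kinv (hq : q ≠ 0) (i : Fin 2) : opVV q (.K i) * opVV q (.Kinv i) = 1 := by
  refine LinearMap.ext fun v => ?_
  fin_cases i <;> simp [opVV, mapK, mapKinv, scale_scale, hq, scale_one_one, smul_smul]

theorem opVV_Kinv_mul_K (hq : q ≠ 0) (i : Fin 2) : opVV q (.Kinv i) * opVV q (.K i) = 1 := by
  refine LinearMap.ext fun v => ?_
  fin_cases i <;> simp [opVV, mapK, mapKinv, scale_scale, hq, scale_one_one, smul_smul]

theorem opVV_D_mul_Dinv (hq : q ≠ 0) : opVV q .D * opVV q .Dinv = 1 := by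
  refine LinearMap.ext fun v => ?_
  simp [opVV, mapX, mapXinv, scale_scale, hq, scale_one_one]

theorem opVV_Dinv_mul_D (hq : q ≠ 0) : opVV q .Dinv * opVV q .D = 1 := by
  refine LinearMap.ext fun v => ?_
  simp [opVV, mapX, mapXinv, scale_scale, hq, scale_one_one]

theorem opVV_K_comm_K (i j : Fin 2) :
    opVV q (.K i) * opVV q (.K j) = opVV q (.K j) * opVV q (.K i) := by
  refine LinearMap.ext fun v => ?_
  fin_cases i <;> fin_cases j <;> simp [opVV, mapK, mapKinv, scale_scale, mul_comm]

theorem opVV_D_comm_K (i : Fin 2) :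
    opVV q .D * opVV q (.K i) = opVV q (.K i) * opVV q .D := by
  refine LinearMap.ext fun v => ?_
  fin_cases i <;> simp [opVV, mapK, mapKinv, mapXinv, scale_scale, mul_comm]

theorem opVV_K_mul_E (hq : q ≠ 0) (i j : Fin 2) :
    opVV q (.K i) * opVV q (.E j) = q ^ cartan i j • (opVV q (.E j) * opVV q (.K i)) := by
  refine LinearMap.ext fun v => ?_
  fin_cases i <;> fin_cases j <;>
    simp [opVV, mapK, mapKinv, stripR_scale, cartan, wt, smul_smul, hq] <;> field_simp

theorem opVV_K_mul_F (hq : q ≠ 0) (i j : Fin 2) :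
    opVV q (.K i) * opVV q (.F j) = q ^ (-cartan i j) • (opVV q (.F j) * opVV q (.K i)) := by
  have h := mul_inv_cancel₀ (pow_ne_zero 2 hq)
  have h' := inv_mul_cancel₀ (pow_ne_zero 2 hq)
  refine LinearMap.ext fun v => ?_
  fin_cases i <;> fin_cases j <;>
    simp [opVV, mapK, mapKinv, scale_star hq, scale_letter, scale_scale, cartan, wt, smul_sub, h,
      h'] <;>
    module

theorem opVV_D_mul_F_zero (hq : q ≠ 0) :
    opVV q .D * opVV q (.F 0) = q⁻¹ • (opVV q (.F 0) * opVV q .D) := by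
  refine LinearMap.ext fun v => ?_
  simp [opVV, mapKinv, mapXinv, scale_star hq, scale_letter, scale_scale, wt, smul_sub,
    mul_comm]
  module

theorem opVV_D_mul_F_one (hq : q ≠ 0) :
    opVV q .D * opVV q (.F 1) = opVV q (.F 1) * opVV q .D := by
  refine LinearMap.ext fun v => ?_
  simp [opVV, mapK, mapXinv, scale_star hq, scale_letter, scale_scale, wt, smul_sub, mul_comm]

theorem opVV_D_mul_E_zero (hq : q ≠ 0) :
    opVV q .D * opVV q (.E 0) = q • (opVV q (.E 0) * opVV q .D) := by
  refine LinearMap.ext fun v => ?_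
  simp [opVV, mapXinv, stripR_scale, wt, smul_smul, hq]

theorem opVV_D_mul_E_one :
    opVV q .D * opVV q (.E 1) = opVV q (.E 1) * opVV q .D := by
  refine LinearMap.ext fun v => ?_
  simp [opVV, mapXinv, stripR_scale, wt]

theorem opVV_E_comm_F (hq : q ≠ 0) (i j : Fin 2) :
    comm (opVV q (.E i)) (opVV q (.F j)) =
      if i = j then (q - q⁻¹)⁻¹ • (opVV q (.K i) - opVV q (.Kinv i)) else 0 := by
  refine LinearMap.ext fun v => ?_
  have h1 (u : VV 𝔽) : kap q .x u = mapK q u := by rw [kap_x]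
  have h2 (u : VV 𝔽) : kap q .y u = mapKinv q u := by rw [kap_y]
  fin_cases i <;> fin_cases j <;>
    simp [comm, opVV, stripR_star hq, h1, h2, stripR_letter, mapK, mapKinv, stripR_scale,
      scale_letter, wt, star_one_right, star_one_left, hq, smul_sub, smul_smul] <;>
    match_scalars <;> field_simp <;> ring

theorem inv_mul_of_mul {A : Type*} [Ring A] [Algebra 𝔽 A] {k k' f : A} {s : 𝔽} (hs : s ≠ 0)
    (h1 : k * k' = 1) (h2 : k' * k = 1) (h : k * f = s • (f * k)) :
    k' * f = s⁻¹ • (f * k') := by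
  have : k' * (k * f) * k' = k' * (s • (f * k)) * k' := by rw [h]
  rw [← mul_assoc k', h2, one_mul, mul_smul_comm, smul_mul_assoc, mul_assoc, mul_assoc f, h1,
    mul_one] at this
  rw [this, inv_smul_smul₀ hs]

theorem opVV_Kinv_mul_F (hq : q ≠ 0) (i j : Fin 2) :
    opVV q (.Kinv i) * opVV q (.F j) = q ^ cartan i j • (opVV q (.F j) * opVV q (.Kinv i)) := by
  have := inv_mul_of_mul (zpow_ne_zero _ hq) (opVV_K_mul_Kinv hq i) (opVV_Kinv_mul_K hq i)
    (opVV_K_mul_F hq i j)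
  rwa [zpow_neg, inv_inv] at this

theorem cartan_self (i : Fin 2) : cartan i i = 2 := by fin_cases i <;> rfl

theorem cartan_of_ne {i j : Fin 2} (h : i ≠ j) : cartan i j = -2 := by
  fin_cases i <;> fin_cases j <;> first | rfl | exact absurd rfl h

theorem opVV_E_comm_serre_F (hq : q ≠ 0) {i j : Fin 2} (hij : i ≠ j) (l : Fin 2) :
    opVV q (.E l) * serre q (opVV q (.F i)) (opVV q (.F j)) =
      serre q (opVV q (.F i)) (opVV q (.F j)) * opVV q (.E l) := by
  have hc (m : Fin 2) : opVV q (.E m) * opVV q (.F m) = opVV q (.F m) * opVV q (.E m) +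
      ((q - q⁻¹)⁻¹ • opVV q (.K m) - (q - q⁻¹)⁻¹ • opVV q (.Kinv m)) := by
    rw [← sub_eq_iff_eq_add']
    refine (opVV_E_comm_F hq m m).trans ?_
    rw [if_pos rfl, smul_sub]
  have hc0 {m n : Fin 2} (h : m ≠ n) :
      opVV q (.E m) * opVV q (.F n) = opVV q (.F n) * opVV q (.E m) := by
    have := opVV_E_comm_F hq m n
    rwa [if_neg h, comm, sub_eq_zero] at this
  have hk (m n : Fin 2) := opVV_K_mul_F hq m n
  have hk' (m n : Fin 2) := opVV_Kinv_mul_F hq m n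
  obtain rfl | rfl : l = i ∨ l = j := by omega
  · refine commute_serre_left hq (hc l) (hc0 hij) ?_ ?_ ?_ ?_ <;>
      simp only [smul_mul_assoc, mul_smul_comm, hk, hk', cartan_self, cartan_of_ne hij, neg_neg,
        zpow_neg, zpow_ofNat] <;>
      rw [smul_comm]
  · refine commute_serre_right hq (hc0 hij.symm) (hc l) ?_ ?_ <;>
      simp only [smul_mul_assoc, mul_smul_comm, hk, hk', cartan_of_ne hij.symm, neg_neg,
        zpow_neg, zpow_ofNat] <;>
      rw [smul_comm]

theorem serre_opVV_F (hq : q ≠ 0) {i j : Fin 2} (hij : i ≠ j) :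
    serre q (opVV q (.F i)) (opVV q (.F j)) = 0 := by
  refine eq_zero_of_commute_stripR (fun c => ?_) fun v => ?_
  · cases c
    · exact opVV_E_comm_serre_F hq hij 0
    · exact opVV_E_comm_serre_F hq hij 1
  · simp only [serre, comm, qcomm, LinearMap.sub_apply, LinearMap.smul_apply, Module.End.mul_apply,
      mul_sub, sub_mul, mul_smul_comm, smul_mul_assoc, map_sub, map_smul, eps_opVV_F hq, smul_zero,
      sub_zero]

/-- The `q`-Serre element of the two deletions commutes with left `q`-shuffle multiplication by a
letter. -/
theorem serre_stripR_letter_star (hq : q ≠ 0) {a b : Letter} (hab : a ≠ b) (c : Letter)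
    (v : VV 𝔽) :
    serre q (stripR 𝔽 a) (stripR 𝔽 b) (star q (letter 𝔽 c) v) =
      star q (letter 𝔽 c) (serre q (stripR 𝔽 a) (stripR 𝔽 b) v) := by
  let k : Module.End 𝔽 (VV 𝔽) := -(kap q c).toLinearMap
  let m : Module.End 𝔽 (VV 𝔽) := star q (letter 𝔽 c)
  have hm : m * stripR 𝔽 c = stripR 𝔽 c * m + (k - 0) := by
    refine LinearMap.ext fun v => ?_
    simp [m, k, Module.End.mul_apply, stripR_letter_star hq]
  have hm0 {d : Letter} (h : c ≠ d) : m * stripR 𝔽 d = stripR 𝔽 d * m := by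
    refine LinearMap.ext fun v => ?_
    simp [m, Module.End.mul_apply, stripR_letter_star hq, h]
  have hk (d : Letter) : k * stripR 𝔽 d = q ^ (-form d c) • (stripR 𝔽 d * k) := by
    refine LinearMap.ext fun v => ?_
    simp [k, Module.End.mul_apply, stripR_kap, smul_smul, zpow_ne_zero, hq]
  have key : m * serre q (stripR 𝔽 a) (stripR 𝔽 b) = serre q (stripR 𝔽 a) (stripR 𝔽 b) * m := by
    obtain rfl | hca := eq_or_ne c a
    · refine commute_serre_left hq hm (hm0 hab) ?_ ?_ (by simp) (by simp)
      · rw [hk]; simp [form]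
      · rw [hk]; simp [form, hab.symm]
    · obtain rfl : c = b := by cases a <;> cases b <;> cases c <;> simp_all
      refine commute_serre_right hq (hm0 hca) hm ?_ (by simp)
      rw [hk]; simp [form, hab]
  exact (LinearMap.congr_fun key v).symm

theorem serre_stripR_eq_zero (hq : q ≠ 0) {a b : Letter} (hab : a ≠ b) {v : VV 𝔽}
    (hv : v ∈ UU q) : serre q (stripR 𝔽 a) (stripR 𝔽 b) v = 0 := by
  refine UU_induction (P := fun v => serre q (stripR 𝔽 a) (stripR 𝔽 b) v = 0) hq ?_ ?_ ?_ ?_ hv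
  · simp [serre, comm, qcomm, stripR_one]
  · intro u v hu hv; rw [map_add, hu, hv, add_zero]
  · intro c u hu; rw [map_smul, hu, smul_zero]
  · intro c u _ hu; rw [serre_stripR_letter_star hq hab, hu, map_zero]

theorem opVV_F_zero (v : VV 𝔽) : opVV q (.F 0) v = (q - q⁻¹)⁻¹ •
    (q • star q (mapKinv q v) (letter 𝔽 .x) - q⁻¹ • star q (letter 𝔽 .x) v) := by
  simp [opVV]

theorem opVV_F_one (v : VV 𝔽) : opVV q (.F 1) v = (q - q⁻¹)⁻¹ •
    (star q (mapK q v) (letter 𝔽 .y) - star q (letter 𝔽 .y) v) := by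
  simp [opVV]

theorem opVV_mem_UU (hq : q ≠ 0) (g : Gen) {v : VV 𝔽} (hv : v ∈ UU q) : opVV q g v ∈ UU q := by
  have hs (a b : 𝔽) : scale a b v ∈ UU q := scale_mem_UU hq a b hv
  match g with
  | .K 0 => exact Submodule.smul_mem _ _ (hs _ _)
  | .K 1 => exact hs _ _
  | .Kinv 0 => exact Submodule.smul_mem _ _ (hs _ _)
  | .Kinv 1 => exact hs _ _
  | .D => exact hs _ _
  | .Dinv => exact hs _ _
  | .E 0 => exact stripR_mem_UU hq .x hv
  | .E 1 => exact stripR_mem_UU hq .y hv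
  | .F 0 =>
    rw [opVV_F_zero]
    exact Submodule.smul_mem _ _ (sub_mem
      (Submodule.smul_mem _ _ (star_mem_UU (hs _ _) (letter_mem_UU _)))
      (Submodule.smul_mem _ _ (star_mem_UU (letter_mem_UU _) hv)))
  | .F 1 =>
    rw [opVV_F_one]
    exact Submodule.smul_mem _ _ (sub_mem (star_mem_UU (hs _ _) (letter_mem_UU _))
      (star_mem_UU (letter_mem_UU _) hv))

end Operators

/-! ### The action on `𝕌` -/

section Action

variable {𝔽 : Type u} [Field 𝔽] {q : 𝔽}

/-- The operators by which the generators of `U_q(ŝl₂)` act on `𝕌`. -/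
noncomputable def opUU (hq : q ≠ 0) (g : Gen) : Module.End 𝔽 (UU q) :=
  (opVV q g).restrict fun _ hv => opVV_mem_UU hq g hv

theorem coe_lift_opUU (hq : q ≠ 0) (z : FreeAlgebra 𝔽 Gen) (v : UU q) :
    (FreeAlgebra.lift 𝔽 (opUU hq) z v : VV 𝔽) = FreeAlgebra.lift 𝔽 (opVV q) z v := by
  induction z using FreeAlgebra.induction generalizing v with
  | grade0 r => simp [Module.algebraMap_end_apply]
  | grade1 g => simp [opUU]
  | mul a b ha hb => simp only [map_mul, Module.End.mul_apply, ha, hb]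
  | add a b ha hb => simp only [map_add, LinearMap.add_apply, Submodule.coe_add, ha, hb]

theorem lift_opVV_rel (hq : q ≠ 0) {z z' : FreeAlgebra 𝔽 Gen} (h : Rel q z z') {v : VV 𝔽}
    (hv : v ∈ UU q) :
    FreeAlgebra.lift 𝔽 (opVV q) z v = FreeAlgebra.lift 𝔽 (opVV q) z' v := by
  have conj {k k' f : Module.End 𝔽 (VV 𝔽)} {s : 𝔽} (h1 : k * k' = 1)
      (h : k * f = s • (f * k)) : k * f * k' = s • f := by
    rw [h, smul_mul_assoc, mul_assoc, h1, mul_one]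
  have hKK' := opVV_K_mul_Kinv hq
  cases h with
  | K_Kinv i => simp only [map_mul, FreeAlgebra.lift_ι_apply, opVV_K_mul_Kinv hq, map_one]
  | Kinv_K i => simp only [map_mul, FreeAlgebra.lift_ι_apply, opVV_Kinv_mul_K hq, map_one]
  | D_Dinv => simp only [map_mul, FreeAlgebra.lift_ι_apply, opVV_D_mul_Dinv hq, map_one]
  | Dinv_D => simp only [map_mul, FreeAlgebra.lift_ι_apply, opVV_Dinv_mul_D hq, map_one]
  | K_K i j =>
    simp only [comm, map_sub, map_mul, FreeAlgebra.lift_ι_apply, opVV_K_comm_K i j, sub_self,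
      map_zero]
  | D_K i =>
    simp only [comm, map_sub, map_mul, FreeAlgebra.lift_ι_apply, opVV_D_comm_K i, sub_self,
      map_zero]
  | K_E i j =>
    simp only [map_mul, map_smul, FreeAlgebra.lift_ι_apply]
    rw [conj (hKK' i) (opVV_K_mul_E hq i j)]
  | K_F i j =>
    simp only [map_mul, map_smul, FreeAlgebra.lift_ι_apply]
    rw [conj (hKK' i) (opVV_K_mul_F hq i j)]
  | D_E_zero =>
    simp only [map_mul, map_smul, FreeAlgebra.lift_ι_apply]
    rw [conj (opVV_D_mul_Dinv hq) (opVV_D_mul_E_zero hq)]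
  | D_F_zero =>
    simp only [map_mul, map_smul, FreeAlgebra.lift_ι_apply]
    rw [conj (opVV_D_mul_Dinv hq) (opVV_D_mul_F_zero hq)]
  | D_E_one =>
    simp only [comm, map_sub, map_mul, FreeAlgebra.lift_ι_apply, opVV_D_mul_E_one, sub_self,
      map_zero]
  | D_F_one =>
    simp only [comm, map_sub, map_mul, FreeAlgebra.lift_ι_apply, opVV_D_mul_F_one hq, sub_self,
      map_zero]
  | E_F i j =>
    have := opVV_E_comm_F hq i j
    simp only [comm, map_sub, map_mul, FreeAlgebra.lift_ι_apply] at this ⊢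
    rw [this]
    split_ifs <;> simp
  | serre_E i j hij =>
    have e : FreeAlgebra.lift 𝔽 (opVV q) (serre q (gen 𝔽 (.E i)) (gen 𝔽 (.E j))) =
        serre q (opVV q (.E i)) (opVV q (.E j)) := by
      simp only [serre, comm, qcomm, map_sub, map_mul, map_smul, FreeAlgebra.lift_ι_apply]
    rw [e, map_zero, LinearMap.zero_apply]
    fin_cases i <;> fin_cases j
    · exact absurd rfl hij
    · exact serre_stripR_eq_zero hq (by decide) hv
    · exact serre_stripR_eq_zero hq (by decide) hv
    · exact absurd rfl hij
  | serre_F i j hij =>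
    have e : FreeAlgebra.lift 𝔽 (opVV q) (serre q (gen 𝔽 (.F i)) (gen 𝔽 (.F j))) =
        serre q (opVV q (.F i)) (opVV q (.F j)) := by
      simp only [serre, comm, qcomm, map_sub, map_mul, map_smul, FreeAlgebra.lift_ι_apply]
    rw [e, map_zero, serre_opVV_F hq hij]

theorem isShuffleAction_iff {ρ : Uq q →ₐ[𝔽] Module.End 𝔽 (UU q)} :
    IsShuffleAction q ρ ↔ ∀ g (v : UU q), (ρ (Uq.of q g) v : VV 𝔽) = opVV q g v := by
  constructor
  · intro h g v
    match g with
    | .K 0 => exact h.K_zero v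
    | .K 1 => exact h.K_one v
    | .Kinv 0 => exact h.Kinv_zero v
    | .Kinv 1 => exact h.Kinv_one v
    | .D => exact h.D v
    | .Dinv => exact h.Dinv v
    | .E 0 => exact h.E_zero v
    | .E 1 => exact h.E_one v
    | .F 0 => rw [opVV_F_zero]; exact h.F_zero v
    | .F 1 => rw [opVV_F_one]; exact h.F_one v
  · intro h
    exact ⟨h (.E 0), fun v => by rw [h, opVV_F_zero], h (.K 0), h (.Kinv 0), h (.E 1),
      fun v => by rw [h, opVV_F_one], h (.K 1), h (.Kinv 1), h .D, h .Dinv⟩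

theorem exists_isShuffleAction (hq : q ≠ 0) :
    ∃ ρ : Uq q →ₐ[𝔽] Module.End 𝔽 (UU q), IsShuffleAction q ρ := by
  refine ⟨RingQuot.liftAlgHom 𝔽 ⟨FreeAlgebra.lift 𝔽 (opUU hq), fun z z' h => ?_⟩,
    isShuffleAction_iff.2 fun g v => ?_⟩
  · refine LinearMap.ext fun v => Subtype.ext ?_
    rw [coe_lift_opUU, coe_lift_opUU, lift_opVV_rel hq h v.2]
  · rw [Uq.of, RingQuot.liftAlgHom_mkAlgHom_apply, coe_lift_opUU, FreeAlgebra.lift_ι_apply]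

theorem IsShuffleAction.unique {ρ ρ' : Uq q →ₐ[𝔽] Module.End 𝔽 (UU q)}
    (h : IsShuffleAction q ρ) (h' : IsShuffleAction q ρ') : ρ' = ρ := by
  refine RingQuot.ringQuot_ext' 𝔽 (s := Rel q) _ _ (FreeAlgebra.hom_ext (funext fun g => ?_))
  refine LinearMap.ext fun v => Subtype.ext ?_
  exact (isShuffleAction_iff.1 h' g v).trans (isShuffleAction_iff.1 h g v).symm

end Action

/-! ### Submodules of `𝕌` -/

section Module

variable {𝔽 : Type u} [Field 𝔽] {q : 𝔽} {ρ : Uq q →ₐ[𝔽] Module.End 𝔽 (UU q)}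

/-- The inclusion of the module `𝕌` into `𝕍`. -/
noncomputable def UModule.val (ρ : Uq q →ₐ[𝔽] Module.End 𝔽 (UU q)) : UModule ρ →+ VV 𝔽 :=
  (UU q).subtype.toAddMonoidHom

theorem UModule.val_injective : Function.Injective (UModule.val ρ) :=
  Subtype.val_injective

theorem UModule.val_vac : UModule.val ρ (vac ρ) = 1 := rfl

theorem vac_ne_zero : vac ρ ≠ 0 := fun h =>
  one_ne_zero (α := VV 𝔽) (by rw [← UModule.val_vac (ρ := ρ), h, map_zero])

theorem UModule.val_algebraMap_smul (a : 𝔽) (m : UModule ρ) :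
    UModule.val ρ (algebraMap 𝔽 (Uq q) a • m) = a • UModule.val ρ m := by
  change ((ρ (algebraMap 𝔽 (Uq q) a) : Module.End 𝔽 (UU q)) m : VV 𝔽) = _
  rw [AlgHom.commutes]
  rfl

theorem IsShuffleAction.val_smul (h : IsShuffleAction q ρ) (g : Gen) (m : UModule ρ) :
    UModule.val ρ (Uq.of q g • m) = opVV q g (UModule.val ρ m) :=
  isShuffleAction_iff.1 h g m

theorem IsShuffleAction.isBasicVector_vac (hq : q ≠ 0) (h : IsShuffleAction q ρ) :
    IsBasicVector q (vac ρ) := by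
  constructor <;> refine UModule.val_injective ?_
  · rw [h.val_smul, UModule.val_algebraMap_smul, UModule.val_vac]; simp [opVV]
  · rw [h.val_smul, UModule.val_vac]; simp [opVV]
  · rw [h.val_smul, UModule.val_vac]; simp [opVV]
  · rw [h.val_smul, UModule.val_vac, map_zero]; exact stripR_one _
  · rw [pow_two, mul_smul, h.val_smul, h.val_smul, UModule.val_vac, map_zero]
    simp only [opVV_F_zero, star_one_left, star_one_right, mapKinv, scale_letter, wt, map_one,
      map_smul, map_sub, LinearMap.smul_apply]
    match_scalars
    field_simp
    ring
  · rw [h.val_smul, UModule.val_vac, map_zero]; exact stripR_one _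
  · rw [h.val_smul, UModule.val_vac, map_zero]
    simp [opVV, star_one_left, star_one_right]

/-- Repeated deletion of final letters turns a nonzero vector of `𝕌` into a nonzero scalar, so a
nonzero submodule contains the trivial word. -/
theorem IsShuffleAction.boldU_le (h : IsShuffleAction q ρ)
    {W : Submodule (Uq q) (UModule ρ)} (hW : W ≠ ⊥) : boldU ρ ≤ W := by
  have key (v : VV 𝔽) : ∀ m ∈ W, UModule.val ρ m = v → v ≠ 0 → vac ρ ∈ W := by
    induction v using strip_induction with
    | zero => exact fun m _ _ h0 => absurd rfl h0
    | step v ih =>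
      intro m hm hmv hv
      by_cases hc : ∀ c, stripR 𝔽 c v = 0
      · have hv' : v = eps v • 1 := by
          conv_lhs => rw [eq_eps_add_stripR v, hc, hc]
          simp
        have he : eps v ≠ 0 := fun he => hv (by rw [hv', he, zero_smul])
        have : vac ρ = algebraMap 𝔽 (Uq q) (eps v)⁻¹ • m := by
          refine UModule.val_injective ?_
          rw [UModule.val_algebraMap_smul, UModule.val_vac, hmv, eq_inv_smul_iff₀ he, ← hv']
        rw [this]
        exact W.smul_mem _ hm
      · push Not at hc
        obtain ⟨c, hc⟩ := hc
        cases c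
        · exact ih _ _ (W.smul_mem (Uq.of q (.E 0)) hm) (by rw [h.val_smul, hmv]; rfl) hc
        · exact ih _ _ (W.smul_mem (Uq.of q (.E 1)) hm) (by rw [h.val_smul, hmv]; rfl) hc
  obtain ⟨m, hm, hm0⟩ := W.ne_bot_iff.1 hW
  refine (Submodule.span_singleton_le_iff_mem _ _).2 (key _ m hm rfl fun h0 => hm0 ?_)
  exact UModule.val_injective (by rw [h0, map_zero])

theorem IsShuffleAction.isSimpleModule_boldU (h : IsShuffleAction q ρ) :
    IsSimpleModule (Uq q) (boldU ρ) := by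
  rw [isSimpleModule_iff_isAtom]
  refine ⟨(Submodule.ne_bot_iff _).2 ⟨_, vac_mem_boldU ρ, vac_ne_zero⟩, fun W hW => ?_⟩
  by_contra h0
  exact hW.not_ge (h.boldU_le h0)

end Module

/-! ### Vectors of highest weight `Λ₀` -/

section HighestWeight

variable {𝔽 : Type u} [Field 𝔽] {q : 𝔽}

theorem Uq.of_Kinv_mul_K (i : Fin 2) : Uq.of q (.Kinv i) * Uq.of q (.K i) = 1 := by
  simpa [Uq.of] using RingQuot.mkAlgHom_rel 𝔽 (Rel.Kinv_K (q := q) i)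

theorem Uq.of_Dinv_mul_D : Uq.of q .Dinv * Uq.of q .D = 1 := by
  simpa [Uq.of] using RingQuot.mkAlgHom_rel 𝔽 (Rel.Dinv_D (q := q))

theorem Uq.of_K_mul_F (i j : Fin 2) : Uq.of q (.K i) * Uq.of q (.F j) =
    q ^ (-cartan i j) • (Uq.of q (.F j) * Uq.of q (.K i)) := by
  have h : Uq.of q (.K i) * Uq.of q (.F j) * Uq.of q (.Kinv i) =
      q ^ (-cartan i j) • Uq.of q (.F j) := by
    simpa only [Uq.of, map_mul, map_smul] using RingQuot.mkAlgHom_rel 𝔽 (Rel.K_F (q := q) i j)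
  rw [← smul_mul_assoc, ← h, mul_assoc, Uq.of_Kinv_mul_K, mul_one]

theorem Uq.of_D_mul_F (j : Fin 2) : Uq.of q .D * Uq.of q (.F j) =
    ![q⁻¹, 1] j • (Uq.of q (.F j) * Uq.of q .D) := by
  fin_cases j
  · have h : Uq.of q .D * Uq.of q (.F 0) * Uq.of q .Dinv = q⁻¹ • Uq.of q (.F 0) := by
      simpa only [Uq.of, map_mul, map_smul] using RingQuot.mkAlgHom_rel 𝔽 (Rel.D_F_zero (q := q))
    change Uq.of q .D * Uq.of q (.F 0) = q⁻¹ • (Uq.of q (.F 0) * Uq.of q .D)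
    rw [← smul_mul_assoc, ← h, mul_assoc, Uq.of_Dinv_mul_D, mul_one]
  · have h : Uq.of q .D * Uq.of q (.F 1) - Uq.of q (.F 1) * Uq.of q .D = 0 := by
      simpa only [Uq.of, map_mul, map_sub, map_zero, comm] using
        RingQuot.mkAlgHom_rel 𝔽 (Rel.D_F_one (q := q))
    change Uq.of q .D * Uq.of q (.F 1) = (1 : 𝔽) • (Uq.of q (.F 1) * Uq.of q .D)
    rw [one_smul, sub_eq_zero.1 h]

theorem Uq.of_E_mul_F (i j : Fin 2) : Uq.of q (.E i) * Uq.of q (.F j) =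
    Uq.of q (.F j) * Uq.of q (.E i) +
      if i = j then (q - q⁻¹)⁻¹ • (Uq.of q (.K i) - Uq.of q (.Kinv i)) else 0 := by
  rw [← sub_eq_iff_eq_add']
  have h := RingQuot.mkAlgHom_rel 𝔽 (Rel.E_F (q := q) i j)
  rw [apply_ite (RingQuot.mkAlgHom 𝔽 (Rel q))] at h
  simpa only [Uq.of, map_mul, map_sub, map_smul, map_zero, comm] using h

theorem Uq.induction {P : Uq q → Prop} (algebraMap : ∀ a : 𝔽, P (algebraMap 𝔽 (Uq q) a))
    (of : ∀ g, P (Uq.of q g)) (mul : ∀ a b, P a → P b → P (a * b))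
    (add : ∀ a b, P a → P b → P (a + b)) (z : Uq q) : P z := by
  obtain ⟨z, rfl⟩ := RingQuot.mkAlgHom_surjective 𝔽 (Rel q) z
  induction z using FreeAlgebra.induction with
  | grade0 r => rw [AlgHom.commutes]; exact algebraMap r
  | grade1 g => exact of g
  | mul a b ha hb => rw [map_mul]; exact mul _ _ ha hb
  | add a b ha hb => rw [map_add]; exact add _ _ ha hb

variable {M : Type*} [AddCommGroup M] [Module (Uq q) M] [Module 𝔽 M] [IsScalarTower 𝔽 (Uq q) M]

theorem smul_smul_scalar (z : Uq q) (a : 𝔽) (m : M) : z • a • m = a • z • m := by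
  rw [← algebraMap_smul (Uq q) a m, ← algebraMap_smul (Uq q) a (z • m), smul_smul, smul_smul,
    Algebra.commutes]

/-- The vector `F_{i₁} ⋯ F_{iₙ} v`. -/
noncomputable def loweringWord (q : 𝔽) {M : Type*} [AddCommGroup M] [Module (Uq q) M] (v : M)
    (l : List (Fin 2)) : M :=
  l.foldr (fun i m => Uq.of q (.F i) • m) v

/-- The span of the vectors `F_{i₁} ⋯ F_{iₙ} v`. -/
noncomputable def loweringSpan (q : 𝔽) {M : Type*} [AddCommGroup M] [Module (Uq q) M]
    [Module 𝔽 M] (v : M) : Submodule 𝔽 M :=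
  Submodule.span 𝔽 (Set.range (loweringWord q v))

/-- The span of the vectors `F_{i₁} ⋯ F_{iₙ} v` with `n ≥ 1`. -/
noncomputable def loweringSpanPos (q : 𝔽) {M : Type*} [AddCommGroup M] [Module (Uq q) M]
    [Module 𝔽 M] (v : M) : Submodule 𝔽 M :=
  Submodule.span 𝔽 (loweringWord q v '' {l | l ≠ []})

theorem loweringWord_mem {M : Type*} [AddCommGroup M] [Module (Uq q) M] [Module 𝔽 M] (v : M)
    (l : List (Fin 2)) :
    loweringWord q v l ∈ loweringSpan q v :=
  Submodule.subset_span ⟨l, rfl⟩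

theorem smul_mem_loweringSpan {v : M} {z : Uq q}
    (h : ∀ l, z • loweringWord q v l ∈ loweringSpan q v) {m : M} (hm : m ∈ loweringSpan q v) :
    z • m ∈ loweringSpan q v := by
  induction hm using Submodule.span_induction with
  | mem m hm => obtain ⟨l, rfl⟩ := hm; exact h l
  | zero => rw [smul_zero]; exact zero_mem _
  | add m n _ _ hm hn => rw [smul_add]; exact add_mem hm hn
  | smul a m _ hm => rw [smul_smul_scalar]; exact Submodule.smul_mem _ _ hm

theorem F_smul_mem_loweringSpan {v : M} (i : Fin 2) {m : M} (hm : m ∈ loweringSpan q v) :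
    Uq.of q (.F i) • m ∈ loweringSpan q v :=
  smul_mem_loweringSpan (fun l => loweringWord_mem v (i :: l)) hm

theorem exists_smul_loweringWord {v : M} {k : Uq q} {s : Fin 2 → 𝔽} (hs : ∀ i, s i ≠ 0)
    (hk : ∀ i, k * Uq.of q (.F i) = s i • (Uq.of q (.F i) * k)) {c : 𝔽} (hc : c ≠ 0)
    (hv : k • v = c • v) (l : List (Fin 2)) :
    ∃ c : 𝔽, c ≠ 0 ∧ k • loweringWord q v l = c • loweringWord q v l := by
  induction l with
  | nil => exact ⟨c, hc, hv⟩
  | cons i l ih =>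
    obtain ⟨d, hd, h⟩ := ih
    refine ⟨s i * d, mul_ne_zero (hs i) hd, ?_⟩
    change k • Uq.of q (.F i) • loweringWord q v l = _ • Uq.of q (.F i) • loweringWord q v l
    rw [smul_smul, hk, smul_assoc, mul_smul, h, smul_smul_scalar, smul_smul]

theorem smul_mem_of_eigen {v : M} {k k' : Uq q} (hk' : k' * k = 1)
    (h : ∀ l, ∃ c : 𝔽, c ≠ 0 ∧ k • loweringWord q v l = c • loweringWord q v l) {m : M}
    (hm : m ∈ loweringSpan q v) :
    k • m ∈ loweringSpan q v ∧ k' • m ∈ loweringSpan q v := by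
  refine ⟨smul_mem_loweringSpan (fun l => ?_) hm, smul_mem_loweringSpan (fun l => ?_) hm⟩
  · obtain ⟨c, -, h⟩ := h l
    rw [h]
    exact Submodule.smul_mem _ _ (loweringWord_mem v l)
  · obtain ⟨c, hc, h⟩ := h l
    have : k' • loweringWord q v l = c⁻¹ • loweringWord q v l := by
      rw [eq_inv_smul_iff₀ hc, ← smul_smul_scalar, ← h, smul_smul, hk', one_smul]
    rw [this]
    exact Submodule.smul_mem _ _ (loweringWord_mem v l)

/-- `v` is a vector of highest weight `Λ₀`. -/
structure IsHighestWeightVector (q : 𝔽) {M : Type*} [AddCommGroup M] [Module (Uq q) M]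
    [Module 𝔽 M] (v : M) : Prop where
  E (i : Fin 2) : Uq.of q (.E i) • v = 0
  K_zero : Uq.of q (.K 0) • v = q • v
  K_one : Uq.of q (.K 1) • v = v
  D : Uq.of q .D • v = v

/-- The span of the words in the `F_i` applied to a highest weight vector is a submodule: the `K_i`
and `D` scale these words, and an `E_i` is moved to the right past the `F_j`. -/
theorem IsHighestWeightVector.smul_mem (hq : q ≠ 0) {v : M} (hv : IsHighestWeightVector q v)
    (z : Uq q) {m : M} (hm : m ∈ loweringSpan q v) : z • m ∈ loweringSpan q v := by
  have hK (i : Fin 2) {m : M} (hm : m ∈ loweringSpan q v) :=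
    smul_mem_of_eigen (Uq.of_Kinv_mul_K i)
      (exists_smul_loweringWord (c := ![q, 1] i) (fun j => zpow_ne_zero (-cartan i j) hq)
        (Uq.of_K_mul_F i)
        (by fin_cases i <;> simp [hq])
        (by fin_cases i <;> simp [hv.K_zero, hv.K_one])) hm
  have hD {m : M} (hm : m ∈ loweringSpan q v) :=
    smul_mem_of_eigen Uq.of_Dinv_mul_D
      (exists_smul_loweringWord (s := ![q⁻¹, 1]) (fun j => by fin_cases j <;> simp [hq])
        Uq.of_D_mul_F one_ne_zero (by rw [hv.D, one_smul])) hm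
  induction z using Uq.induction generalizing m with
  | algebraMap a => rw [algebraMap_smul]; exact Submodule.smul_mem _ _ hm
  | mul a b ha hb => rw [mul_smul]; exact ha (hb hm)
  | add a b ha hb => rw [add_smul]; exact add_mem (ha hm) (hb hm)
  | of g =>
    cases g with
    | K i => exact (hK i hm).1
    | Kinv i => exact (hK i hm).2
    | D => exact (hD hm).1
    | Dinv => exact (hD hm).2
    | F i => exact F_smul_mem_loweringSpan i hm
    | E i =>
      refine smul_mem_loweringSpan (fun l => ?_) hm
      induction l with
      | nil => change _ • v ∈ _; rw [hv.E]; exact zero_mem _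
      | cons j l ih =>
        change Uq.of q (.E i) • Uq.of q (.F j) • loweringWord q v l ∈ _
        rw [smul_smul, Uq.of_E_mul_F, add_smul, mul_smul]
        refine add_mem (F_smul_mem_loweringSpan j ih) ?_
        split_ifs
        · rw [smul_assoc, sub_smul]
          have h := hK i (loweringWord_mem v l)
          exact Submodule.smul_mem _ _ (sub_mem h.1 h.2)
        · rw [zero_smul]; exact zero_mem _

theorem IsHighestWeightVector.exists_eq_add (hq : q ≠ 0) {v : M}
    (hv : IsHighestWeightVector q v) (z : Uq q) :
    ∃ c : 𝔽, ∃ m ∈ loweringSpanPos q v, z • v = c • v + m := by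
  have h := hv.smul_mem hq z (loweringWord_mem v [])
  have hle : loweringSpan q v ≤ Submodule.span 𝔽 {v} ⊔ loweringSpanPos q v := by
    refine Submodule.span_le.2 ?_
    rintro _ ⟨l, rfl⟩
    by_cases hl : l = []
    · subst hl
      exact Submodule.mem_sup_left (Submodule.mem_span_singleton_self v)
    · exact Submodule.mem_sup_right (Submodule.subset_span ⟨l, hl, rfl⟩)
  obtain ⟨a, ha, m, hm, h⟩ := Submodule.mem_sup.1 (hle h)
  obtain ⟨c, rfl⟩ := Submodule.mem_span_singleton.1 ha
  exact ⟨c, m, hm, h.symm⟩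

/-- The element `D³K₁`. It acts on `F_{i₁} ⋯ F_{iₙ} v`, where `v` has weight `Λ₀`, as `q ^ (-d)`
where `d` is the number of factors `F₀` plus twice the number of factors `F₁`. -/
noncomputable def gradingElement (q : 𝔽) : Uq q :=
  Uq.of q .D * Uq.of q .D * Uq.of q .D * Uq.of q (.K 1)

theorem gradingElement_mul_F (hq : q ≠ 0) (i : Fin 2) :
    gradingElement q * Uq.of q (.F i) =
      (q ^ (i.val + 1))⁻¹ • (Uq.of q (.F i) * gradingElement q) := by
  have hK (z : Uq q) : Uq.of q (.K 1) * (Uq.of q (.F i) * z) =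
      q ^ (-cartan 1 i) • (Uq.of q (.F i) * (Uq.of q (.K 1) * z)) := by
    rw [← mul_assoc, Uq.of_K_mul_F, smul_mul_assoc, mul_assoc]
  have hD (z : Uq q) : Uq.of q .D * (Uq.of q (.F i) * z) =
      ![q⁻¹, 1] i • (Uq.of q (.F i) * (Uq.of q .D * z)) := by
    rw [← mul_assoc, Uq.of_D_mul_F, smul_mul_assoc, mul_assoc]
  simp only [gradingElement, mul_assoc, Uq.of_K_mul_F, hD, mul_smul_comm, smul_smul]
  congr 1
  fin_cases i
  · simp [cartan]; field_simp
  · simp [cartan]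

theorem IsHighestWeightVector.gradingElement_smul {M : Type*} [AddCommGroup M] [Module (Uq q) M]
    [Module 𝔽 M] {v : M} (hv : IsHighestWeightVector q v) :
    gradingElement q • v = v := by
  simp only [gradingElement, mul_smul, hv.K_one, hv.D]

theorem IsHighestWeightVector.exists_gradingElement_smul (hq : q ≠ 0) {v : M}
    (hv : IsHighestWeightVector q v) (l : List (Fin 2)) :
    ∃ d : ℕ, l.length ≤ d ∧
      gradingElement q • loweringWord q v l = (q ^ d)⁻¹ • loweringWord q v l := by
  induction l with
  | nil => exact ⟨0, le_rfl, by simpa [loweringWord] using hv.gradingElement_smul⟩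
  | cons i l ih =>
    obtain ⟨d, hd, h⟩ := ih
    refine ⟨i.val + 1 + d, by rw [List.length_cons]; omega, ?_⟩
    change _ • Uq.of q (.F i) • loweringWord q v l = _ • Uq.of q (.F i) • loweringWord q v l
    rw [smul_smul, gradingElement_mul_F hq, smul_assoc, mul_smul, h, smul_smul_scalar, smul_smul,
      pow_add _ _ d, mul_inv]

theorem aeval_smul_of_smul_eq {h : Uq q} {m : M} {c : 𝔽} (hm : h • m = c • m)
    (p : Polynomial 𝔽) : Polynomial.aeval h p • m = p.eval c • m := by
  induction p using Polynomial.induction_on with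
  | C a => simp
  | add p r hp hr => simp only [map_add, add_smul, hp, hr, Polynomial.eval_add]
  | monomial n a ih =>
    rw [pow_succ', ← mul_assoc, mul_comm _ Polynomial.X, mul_assoc, map_mul, Polynomial.aeval_X,
      mul_smul, ih, smul_smul_scalar, hm, smul_smul,
      Polynomial.eval_mul (p := Polynomial.X), Polynomial.eval_X, mul_comm]

theorem IsHighestWeightVector.aeval_gradingElement_smul {v : M}
    (hv : IsHighestWeightVector q v) (p : Polynomial 𝔽) :
    Polynomial.aeval (gradingElement q) p • v = p.eval 1 • v :=
  aeval_smul_of_smul_eq (by rw [hv.gradingElement_smul, one_smul]) p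

/-- The grading element separates a highest weight vector from the words of positive length
applied to it: some polynomial in it kills a given combination of the latter but not the former. -/
theorem IsHighestWeightVector.exists_aeval_smul_eq_zero (hq : q ≠ 0)
    (hq' : ∀ n : ℕ, 0 < n → q ^ n ≠ 1) {v : M} (hv : IsHighestWeightVector q v) {m : M}
    (hm : m ∈ loweringSpanPos q v) :
    ∃ p : Polynomial 𝔽, p.eval 1 ≠ 0 ∧ Polynomial.aeval (gradingElement q) p • m = 0 := by
  induction hm using Submodule.span_induction with
  | mem m hm =>
    obtain ⟨l, hl, rfl⟩ := hm
    obtain ⟨d, hd, h⟩ := hv.exists_gradingElement_smul hq l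
    refine ⟨Polynomial.X - Polynomial.C (q ^ d)⁻¹, ?_, ?_⟩
    · rw [Polynomial.eval_sub, Polynomial.eval_X, Polynomial.eval_C, sub_ne_zero, ne_comm,
        inv_ne_one]
      exact hq' d ((List.length_pos_iff.2 hl).trans_le hd)
    · rw [aeval_smul_of_smul_eq h]; simp
  | zero => exact ⟨1, by simp, smul_zero _⟩
  | add m n _ _ hm hn =>
    obtain ⟨p, hp, h⟩ := hm
    obtain ⟨r, hr, h'⟩ := hn
    refine ⟨p * r, by rw [Polynomial.eval_mul]; exact mul_ne_zero hp hr, ?_⟩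
    rw [smul_add, map_mul, mul_smul _ _ n, h', ← map_mul, mul_comm, map_mul, mul_smul, h,
      smul_zero, smul_zero, add_zero]
  | smul a m _ hm =>
    obtain ⟨p, hp, h⟩ := hm
    exact ⟨p, hp, by rw [smul_smul_scalar, h, smul_zero]⟩

end HighestWeight

/-! ### The Verma module and its simple quotient -/

section Verma

variable {𝔽 : Type u} [Field 𝔽] {q : 𝔽}

/-- The canonical generator of the Verma module. -/
noncomputable def Verma.hwVec (q : 𝔽) : Verma q := (vermaIdeal q).mkQ 1

theorem Verma.smul_hwVec (z : Uq q) : z • Verma.hwVec q = (vermaIdeal q).mkQ z := by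
  rw [Verma.hwVec, ← map_smul, smul_eq_mul, mul_one]

theorem Verma.isHighestWeightVector : IsHighestWeightVector q (Verma.hwVec q) := by
  have hmem {z : Uq q} (h : z ∈ vermaIdeal q) : z • Verma.hwVec q = 0 := by
    rw [Verma.smul_hwVec, Submodule.mkQ_apply, (Submodule.Quotient.mk_eq_zero _).2 h]
  have h1 {z : Uq q} (h : z - 1 ∈ vermaIdeal q) : z • Verma.hwVec q = Verma.hwVec q := by
    have := hmem h
    rwa [sub_smul, one_smul, sub_eq_zero] at this
  refine ⟨fun i => hmem (Submodule.subset_span ?_), ?_, h1 (Submodule.subset_span ?_),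
    h1 (Submodule.subset_span ?_)⟩
  · fin_cases i <;> simp
  · have : (Uq.of q (.K 0) - algebraMap 𝔽 (Uq q) q) • Verma.hwVec q = 0 :=
      hmem (Submodule.subset_span (by simp))
    rwa [sub_smul, sub_eq_zero, algebraMap_smul] at this
  · simp
  · simp

theorem vermaIdeal_smul {M : Type u} [AddCommGroup M] [Module (Uq q) M] {v : M}
    (hv : IsBasicVector q v) {z : Uq q} (hz : z ∈ vermaIdeal q) : z • v = 0 := by
  have hle : vermaIdeal q ≤ LinearMap.ker (LinearMap.toSpanSingleton (Uq q) M v) := by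
    refine Submodule.span_le.2 ?_
    rintro z (rfl | rfl | rfl | rfl | rfl) <;>
      simp [sub_smul, hv.E_zero, hv.E_one, hv.K_zero, hv.K_one, hv.D]
  simpa using hle hz

variable {ρ : Uq q →ₐ[𝔽] Module.End 𝔽 (UU q)}

/-- The homomorphism from the Verma module to `𝕌` that sends the canonical generator to the
trivial word. -/
noncomputable def vermaToUU (h : IsBasicVector q (vac ρ)) : Verma q →ₗ[Uq q] UModule ρ :=
  (vermaIdeal q).liftQ (LinearMap.toSpanSingleton (Uq q) _ (vac ρ)) fun z hz => by
    simpa using vermaIdeal_smul h hz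

theorem vermaToUU_hwVec (h : IsBasicVector q (vac ρ)) : vermaToUU h (Verma.hwVec q) = vac ρ := by
  rw [vermaToUU, Verma.hwVec, Submodule.mkQ_apply, Submodule.liftQ_apply,
    LinearMap.toSpanSingleton_apply, one_smul]

theorem range_vermaToUU (h : IsBasicVector q (vac ρ)) :
    LinearMap.range (vermaToUU h) = boldU ρ := by
  rw [vermaToUU, Submodule.range_liftQ, LinearMap.range_toSpanSingleton, boldU]

theorem vermaToUU_smul_scalar (h : IsBasicVector q (vac ρ)) (a : 𝔽) (m : Verma q) :
    UModule.val ρ (vermaToUU h (a • m)) = a • UModule.val ρ (vermaToUU h m) := by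
  rw [← algebraMap_smul (Uq q) a m, map_smul, UModule.val_algebraMap_smul]

theorem eps_vermaToUU (hq : q ≠ 0) (hρ : IsShuffleAction q ρ) (h : IsBasicVector q (vac ρ))
    {m : Verma q} (hm : m ∈ loweringSpanPos q (Verma.hwVec q)) :
    eps (UModule.val ρ (vermaToUU h m)) = 0 := by
  induction hm using Submodule.span_induction with
  | mem m hm =>
    obtain ⟨l, hl, rfl⟩ := hm
    obtain ⟨i, l, rfl⟩ := List.exists_cons_of_ne_nil hl
    change eps (UModule.val ρ (vermaToUU h (Uq.of q (.F i) • loweringWord q _ l))) = 0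
    rw [map_smul, hρ.val_smul, eps_opVV_F hq]
  | zero => simp
  | add m n _ _ hm hn => rw [map_add, map_add, map_add, hm, hn, add_zero]
  | smul a m _ hm => rw [vermaToUU_smul_scalar, map_smul, hm, smul_zero]

/-- The kernel of the map to `𝕌` is the largest proper submodule of the Verma module. -/
theorem ker_vermaToUU (hq : q ≠ 0) (hq' : ∀ n : ℕ, 0 < n → q ^ n ≠ 1)
    (hρ : IsShuffleAction q ρ) (h : IsBasicVector q (vac ρ)) :
    LinearMap.ker (vermaToUU h) = vermaRadical q := by
  refine le_antisymm (le_sSup fun htop => ?_) (sSup_le fun N hN => ?_)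
  · have : Verma.hwVec q ∈ LinearMap.ker (vermaToUU h) := htop ▸ Submodule.mem_top
    rw [LinearMap.mem_ker, vermaToUU_hwVec] at this
    exact vac_ne_zero this
  · by_contra hker
    have hmap : N.map (vermaToUU h) ≠ ⊥ := fun h0 => hker
      ((Submodule.map_le_iff_le_comap (f := vermaToUU h)).1 h0.le)
    -- otherwise `N` contains a preimage of the trivial word, hence the canonical generator
    obtain ⟨n, hn, hnv⟩ := hρ.boldU_le hmap (vac_mem_boldU ρ)
    obtain ⟨z, rfl⟩ := (vermaIdeal q).mkQ_surjective n
    rw [← Verma.smul_hwVec] at hn hnv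
    obtain ⟨c, m, hm, hz⟩ := Verma.isHighestWeightVector.exists_eq_add hq z
    rw [hz] at hn hnv
    have hc : c = 1 := by
      have := congrArg (fun u => eps (UModule.val ρ u)) hnv
      simpa [vermaToUU_smul_scalar, vermaToUU_hwVec, UModule.val_vac, eps_vermaToUU hq hρ h hm]
        using this
    obtain ⟨p, hp, hpm⟩ := Verma.isHighestWeightVector.exists_aeval_smul_eq_zero hq hq' hm
    have hmem := N.smul_mem (Polynomial.aeval (gradingElement q) p) hn
    rw [smul_add, hpm, add_zero, hc, one_smul,
      Verma.isHighestWeightVector.aeval_gradingElement_smul] at hmem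
    have hgen : Verma.hwVec q ∈ N := by
      have := N.smul_mem (algebraMap 𝔽 (Uq q) (p.eval 1)⁻¹) hmem
      rwa [algebraMap_smul, inv_smul_smul₀ hp] at this
    refine hN (eq_top_iff.2 fun n _ => ?_)
    obtain ⟨z, rfl⟩ := (vermaIdeal q).mkQ_surjective n
    rw [← Verma.smul_hwVec]
    exact N.smul_mem z hgen

theorem exists_boldU_equiv_VLambda0 (hq : q ≠ 0) (hq' : ∀ n : ℕ, 0 < n → q ^ n ≠ 1)
    (hρ : IsShuffleAction q ρ) :
    ∃ φ : boldU ρ ≃ₗ[Uq q] VLambda0 q, φ ⟨vac ρ, vac_mem_boldU ρ⟩ = VLambda0.hwVec q := by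
  have h := hρ.isBasicVector_vac hq
  let φ : VLambda0 q ≃ₗ[Uq q] boldU ρ :=
    (Submodule.quotEquivOfEq _ _ (ker_vermaToUU hq hq' hρ h).symm).trans
      ((vermaToUU h).quotKerEquivRange.trans (LinearEquiv.ofEq _ _ (range_vermaToUU h)))
  refine ⟨φ.symm, ?_⟩
  rw [LinearEquiv.symm_apply_eq]
  exact Subtype.ext (vermaToUU_hwVec h).symm

end Verma

end QShuffle

theorem mainTheorem3 {𝔽 : Type*} [Field 𝔽] [CharZero 𝔽] (q : 𝔽) (hq0 : q ≠ 0)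
    (hq : ∀ n : ℕ, 0 < n → q ^ n ≠ 1) :
    ∃ ρ : QShuffle.Uq q →ₐ[𝔽] Module.End 𝔽 (QShuffle.UU q),
      QShuffle.IsShuffleAction q ρ ∧
      (∀ ρ' : QShuffle.Uq q →ₐ[𝔽] Module.End 𝔽 (QShuffle.UU q),
        QShuffle.IsShuffleAction q ρ' → ρ' = ρ) ∧
      QShuffle.IsBasicVector q (QShuffle.vac ρ) ∧
      (∀ W : Submodule (QShuffle.Uq q) (QShuffle.UModule ρ), W ≠ ⊥ → QShuffle.boldU ρ ≤ W) ∧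
      IsSimpleModule (QShuffle.Uq q) (QShuffle.boldU ρ) ∧
      ∃ φ : QShuffle.boldU ρ ≃ₗ[QShuffle.Uq q] QShuffle.VLambda0 q,
        φ ⟨QShuffle.vac ρ, QShuffle.vac_mem_boldU ρ⟩ = QShuffle.VLambda0.hwVec q := by
  obtain ⟨ρ, hρ⟩ := QShuffle.exists_isShuffleAction hq0
  exact ⟨ρ, hρ, fun _ hρ' => hρ.unique hρ', hρ.isBasicVector_vac hq0, fun _ hW => hρ.boldU_le hW,
    hρ.isSimpleModule_boldU, QShuffle.exists_boldU_equiv_VLambda0 hq0 hq hρ⟩
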